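/- Let $k$ be an algebraically closed field and let $A$ be a basic connected finite dimensional $k$-algebra with radical $\mathfrak r$. Fix a complete set $\{e_1,\dots,e_n\}$ of primitive orthogonal idempotents of $A$, and let $Q$ be the ordinary quiver of $A$: it has vertices $1,\dots,n$ and $\dim_k e_j(\mathfrak r/\mathfrak r^2)e_i$ arrows from $i$ to $j$. Assume that $Q$ has no oriented cycles. Paths are composed from right to left, $kQ$ is the path algebra, and $kQ^+$ is its ideal generated by the arrows. A presentation of $A$ is a surjective $k$-algebra homomorphism $\nu\colon kQ\to A$ that sends the trivial path at $i$ to $e_i$ for every $i$ and whose kernel $I$ is admissible, that is, $(kQ^+)^N\subseteq I\subseteq (kQ^+)^2$ for some $N\ge 2$. A minimal relation of $I$ is a non-zero element $\sum_{i=1}^s t_iu_i$ of $I$, with $t_i\in k\setminus\{0\}$ and $u_1,\dots,u_s$ distinct paths, such that $\sum_{i\in S}t_iu_i\notin I$ for every non-empty proper subset $S$ of $\{1,\dots,s\}$. The homotopy relation $\sim_I$ is the smallest equivalence relation on the walks of $Q$ (paths in the arrows and their formal inverses) that is compatible with concatenation and satisfies $\alpha^{-1}\alpha\sim_I e_x$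 and $\alpha\alpha^{-1}\sim_I e_y$ for every arrow $\alpha\colon x\to y$, and $u\sim_I v$ whenever $u,v$ are paths that appear in a same minimal relation of $I$. For a vertex $x_0$, $\pi_1(Q,I)$ denotes the group of $\sim_I$-classes $[\gamma]_I$ of walks $\gamma$ from $x_0$ to $x_0$. Let $\mathrm{Der}_0(A)$ be the Lie algebra of the $k$-linear derivations $d\colon A\to A$ with $d(e_i)=0$ for every $i$, let $\mathrm{Int}_0(A)$ be its ideal of the maps $a\mapsto ea-ae$ with $e\in ke_1\oplus\dots\oplus ke_n$, and let $\mathrm{HH}^1(A)=\mathrm{Der}_0(A)/\mathrm{Int}_0(A)$. Fix a vertex $x_0$ and a maximal tree $T$ of $Q$ (a subquiver that contains all the vertices and whose underlying graph is a tree), and let $\gamma_x$ be the walk in $T$ of minimal length from $x_0$ to $x$. For a presentation $\nu$ with kernel $I$, let $\theta_\nu\colon \mathrm{Hom}(\pi_1(Q,I),k^+)\to \mathrm{HH}^1(A)$ send a group homomorphism $f$ to the class of the derivation $\widetilde f$ defined by $\widetilde f(\nu(u))=f([\gamma_y^{-1}u\gamma_x]_I)\,\nu(u)$ for every path $u$ from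 $x$ to $y$. Call a $k$-basis $\mathcal B$ of $A$ suitable if $\mathcal B\subseteq\bigcup_{i,j}e_jAe_i$, $\{e_1,\dots,e_n\}\subseteq\mathcal B$ and $\mathcal B\setminus\{e_1,\dots,e_n\}\subseteq\mathfrak r$. A subset $D\subseteq \mathrm{HH}^1(A)$ is diagonalizable if there is a suitable basis $\mathcal B$ of $A$ such that every $f\in D$ is represented by a derivation in $\mathrm{Der}_0(A)$ for which all the elements of $\mathcal B$ are eigenvectors (this does not depend on the representing derivation). Then a subset $D\subseteq \mathrm{HH}^1(A)$ is diagonalizable if and only if there exists a presentation $\nu\colon kQ\to A$ such that $D\subseteq \mathrm{Im}(\theta_\nu)$. -/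

import Mathlib

noncomputable section

namespace BoundQuiver

open Quiver

universe u v w

/-! ### The path algebra -/

section PathAlgebra

variable (k : Type u) [Field k] (V : Type v) [Quiver.{w} V]

/-- A path of the quiver, together with its source and its target. -/
abbrev AnyPath : Type _ := Σ (x : V) (y : V), Path x y

/-- The path algebra `kQ`: the `k`-vector space with basis the set of all paths. -/
def PathAlgebra : Type _ := AnyPath V →₀ k

instance : AddCommGroup (PathAlgebra k V) := inferInstanceAs (AddCommGroup (AnyPath V →₀ k))

instance : Module k (PathAlgebra k V) := inferInstanceAs (Module k (AnyPath V →₀ k))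

variable {V}

/-- The basis element of `kQ` given by a path. -/
def path (p : AnyPath V) : PathAlgebra k V := Finsupp.single p 1

/-- The trivial path at the vertex `x`, seen in `kQ`. -/
def vertex (x : V) : PathAlgebra k V := path k ⟨x, x, Path.nil⟩

/-- The arrow `α`, seen in `kQ`. -/
def arrow {x y : V} (α : x ⟶ y) : PathAlgebra k V := path k ⟨x, y, α.toPath⟩

open Classical in
/-- The product `q p` of two paths: first `p`, then `q`. It is the concatenation if `p` ends where
`q` starts, and zero otherwise. -/
def concat (q p : AnyPath V) : PathAlgebra k V :=
  if h : p.2.1 = q.1 then path k ⟨p.1, q.2.1, p.2.2.comp (q.2.2.cast h.symm rfl)⟩ else 0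

variable {k}

/-- The multiplication of `kQ`, extended bilinearly from paths. -/
def mulMap : PathAlgebra k V →ₗ[k] PathAlgebra k V →ₗ[k] PathAlgebra k V :=
  Finsupp.linearCombination k fun q => Finsupp.linearCombination k fun p => concat k q p

instance : Mul (PathAlgebra k V) := ⟨fun a b => mulMap a b⟩

theorem mul_def (a b : PathAlgebra k V) : a * b = mulMap a b := rfl

theorem path_mul_path (q p : AnyPath V) : path k q * path k p = concat k q p := by
  rw [mul_def, mulMap, path, path]
  erw [Finsupp.linearCombination_single, one_smul, Finsupp.linearCombination_single, one_smul]

theorem path_mul_comp {x y z : V} (p : Path x y) (q : Path y z) :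
    path k ⟨y, z, q⟩ * path k ⟨x, y, p⟩ = path k ⟨x, z, p.comp q⟩ := by
  rw [path_mul_path, concat, dif_pos rfl]
  rfl

theorem path_mul_of_ne {q p : AnyPath V} (h : p.2.1 ≠ q.1) : path k q * path k p = 0 := by
  rw [path_mul_path, concat, dif_neg h]

/-- Two linear maps out of `kQ` are equal if they agree on paths. -/
theorem lin_ext {M : Type*} [AddCommMonoid M] [Module k M] {f g : PathAlgebra k V →ₗ[k] M}
    (h : ∀ p, f (path k p) = g (path k p)) : f = g := by
  refine Finsupp.lhom_ext' fun p => LinearMap.ext_ring ?_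
  exact h p

theorem path_mul_assoc (r q p : AnyPath V) :
    path k r * path k q * path k p = path k r * (path k q * path k p) := by
  have z1 : ∀ a : PathAlgebra k V, 0 * a = 0 := fun a => by rw [mul_def]; simp
  have z2 : ∀ a : PathAlgebra k V, a * 0 = 0 := fun a => by rw [mul_def]; simp
  obtain ⟨c, d, r⟩ := r
  obtain ⟨b, c', q⟩ := q
  obtain ⟨a, b', p⟩ := p
  by_cases h1 : c' = c
  · subst h1
    by_cases h2 : b' = b
    · subst h2
      rw [path_mul_comp, path_mul_comp, path_mul_comp, path_mul_comp, Path.comp_assoc]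
    · rw [path_mul_comp, path_mul_of_ne (by exact h2), path_mul_of_ne (by exact h2), z2]
  · rw [path_mul_of_ne (by exact h1), z1]
    by_cases h2 : b' = b
    · subst h2
      rw [path_mul_comp, path_mul_of_ne (by exact h1)]
    · rw [path_mul_of_ne (p := ⟨a, b', p⟩) (by exact h2), z2]

/-- Two trilinear expressions agree if they agree on paths. -/
theorem lin_ind {p : PathAlgebra k V → Prop} (a : PathAlgebra k V) (h0 : p 0)
    (hadd : ∀ a b, p a → p b → p (a + b)) (hs : ∀ (c : k) q, p (c • path k q)) : p a := by
  refine Finsupp.induction_linear (motive := p) a h0 hadd fun q c => ?_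
  have h : c • path k q = (Finsupp.single q c : AnyPath V →₀ k) :=
    (Finsupp.smul_single c q (1 : k)).trans (by rw [smul_eq_mul, mul_one])
  exact h ▸ hs c q

instance : NonUnitalRing (PathAlgebra k V) where
  __ := (inferInstance : AddCommGroup (PathAlgebra k V))
  left_distrib a b c := by simp only [mul_def, map_add]
  right_distrib a b c := by simp only [mul_def, map_add, LinearMap.add_apply]
  zero_mul a := by simp only [mul_def, map_zero, LinearMap.zero_apply]
  mul_zero a := by simp only [mul_def, map_zero]
  mul_assoc a b c := by
    refine lin_ind (p := fun a => a * b * c = a * (b * c)) a (by simp only [mul_def, map_zero, LinearMap.zero_apply])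
      (fun a a' h h' => by
        simp only [mul_def, map_add, LinearMap.add_apply] at h h' ⊢; rw [h, h'])
      fun x p => ?_
    refine lin_ind (p := fun b => x • path k p * b * c = x • path k p * (b * c)) b
      (by simp only [mul_def, map_zero, LinearMap.zero_apply])
      (fun a a' h h' => by
        simp only [mul_def, map_add, LinearMap.add_apply] at h h' ⊢; rw [h, h'])
      fun y q => ?_
    refine lin_ind (p := fun c => x • path k p * y • path k q * c =
        x • path k p * (y • path k q * c)) c (by simp only [mul_def, map_zero])
      (fun a a' h h' => by simp only [mul_def, map_add] at h h' ⊢; rw [h, h'])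
      fun z r => ?_
    have := path_mul_assoc (k := k) p q r
    simp only [mul_def, map_smul, LinearMap.smul_apply] at this ⊢
    rw [this]

/-- The coefficient of the path `p` in `r`. -/
def coeff (r : PathAlgebra k V) (p : AnyPath V) : k := Finsupp.toFun r p

/-- The coefficient of `p`, as a linear form. -/
def coeffMap (p : AnyPath V) : PathAlgebra k V →ₗ[k] k := Finsupp.lapply p

/-- The finite set of paths that appear in `r` with a non-zero coefficient. -/
def supp (r : PathAlgebra k V) : Finset (AnyPath V) := Finsupp.support r

theorem mem_supp (r : PathAlgebra k V) (p : AnyPath V) : p ∈ supp r ↔ coeff r p ≠ 0 :=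
  Finsupp.mem_support_iff

variable [Fintype V]

/-- The unit of `kQ` is the sum of the trivial paths. -/
instance : One (PathAlgebra k V) := ⟨∑ x, vertex k x⟩

theorem one_def : (1 : PathAlgebra k V) = ∑ x, vertex k x := rfl

instance : Ring (PathAlgebra k V) where
  __ := (inferInstance : NonUnitalRing (PathAlgebra k V))
  one_mul a := by
    refine lin_ind (p := fun a => 1 * a = a) a (mul_zero _) (fun a a' h h' => by rw [mul_add, h, h']) fun c p => ?_
    obtain ⟨x, y, p⟩ := p
    rw [mul_def, map_smul, ← mul_def, one_def, Finset.sum_mul, Finset.sum_eq_single y]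
    · rw [vertex, path_mul_comp, Path.comp_nil]
    · exact fun z _ hz => path_mul_of_ne (fun h => hz h.symm)
    · exact fun h => absurd (Finset.mem_univ y) h
  mul_one a := by
    refine lin_ind (p := fun a => a * 1 = a) a (zero_mul _) (fun a a' h h' => by rw [add_mul, h, h']) fun c p => ?_
    obtain ⟨x, y, p⟩ := p
    rw [mul_def, map_smul, LinearMap.smul_apply, ← mul_def, one_def, Finset.mul_sum,
      Finset.sum_eq_single x]
    · rw [vertex, path_mul_comp, Path.nil_comp]
    · exact fun z _ hz => path_mul_of_ne hz
    · exact fun h => absurd (Finset.mem_univ x) h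

instance : Algebra k (PathAlgebra k V) :=
  Algebra.ofModule (fun c a b => by simp only [mul_def, map_smul, LinearMap.smul_apply])
    (fun c a b => by simp only [mul_def, map_smul])

variable (k V)

/-- The two-sided ideal `kQ⁺` of `kQ` generated by the arrows. -/
def arrowIdeal : Ideal (PathAlgebra k V) :=
  (TwoSidedIdeal.span {a | ∃ (x y : V) (α : x ⟶ y), a = arrow k α}).asIdeal

variable {k V}

/-- An ideal `I` of `kQ` is admissible if `(kQ⁺)^N ⊆ I ⊆ (kQ⁺)^2` for some `N ≥ 2`. -/
def IsAdmissible (I : Ideal (PathAlgebra k V)) : Prop :=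
  ∃ N : ℕ, 2 ≤ N ∧ arrowIdeal k V ^ N ≤ I ∧ I ≤ arrowIdeal k V ^ 2

/-- The part of `r = ∑ t_p p` supported on the set `S` of paths, that is `∑_{p ∈ S} t_p p`. -/
def part (r : PathAlgebra k V) (S : Finset (AnyPath V)) : PathAlgebra k V :=
  ∑ p ∈ S, coeff r p • path k p

/-- A minimal relation of `I`: a non-zero element `∑ t_i u_i` of `I` (with `t_i ≠ 0` and distinct
paths `u_i`) such that `∑_{i ∈ S} t_i u_i ∉ I` for every non-empty proper subset `S` of the index
set. -/
def IsMinimalRelation (I : Ideal (PathAlgebra k V)) (r : PathAlgebra k V) : Prop :=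
  r ∈ I ∧ r ≠ 0 ∧ ∀ S : Finset (AnyPath V), S.Nonempty → S ⊂ supp r → part r S ∉ I

end PathAlgebra

/-! ### Walks, homotopy, the fundamental group -/

section Walks

variable {k : Type u} [Field k] {V : Type v} [Quiver.{w} V]

/-- A walk from `x` to `y`: a path in the double quiver. It is trivial, or extends a walk at its
end by an arrow `α`, or by the formal inverse `α⁻¹` of an arrow. -/
inductive Walk {V : Type v} [Quiver.{w} V] (x : V) : V → Type max v w
  | nil : Walk x x
  | pos {y z : V} (p : Walk x y) (α : y ⟶ z) : Walk x z
  | neg {y z : V} (p : Walk x y) (α : z ⟶ y) : Walk x z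

namespace Walk

/-- The number of arrows and inverse arrows of a walk. -/
def length {x : V} : ∀ {y : V}, Walk x y → ℕ
  | _, nil => 0
  | _, pos p _ => p.length + 1
  | _, neg p _ => p.length + 1

/-- Concatenation: `u.comp v` follows `u` first and `v` afterwards, so it is written `vu` when
walks are read from right to left. -/
def comp {x y : V} (u : Walk x y) : ∀ {z : V}, Walk y z → Walk x z
  | _, nil => u
  | _, pos p α => pos (u.comp p) α
  | _, neg p α => neg (u.comp p) α

/-- The walk `α` given by an arrow. -/
def ofArrow {x y : V} (α : x ⟶ y) : Walk x y := pos nil α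

/-- The walk `α⁻¹` given by the inverse of an arrow. -/
def invArrow {x y : V} (α : x ⟶ y) : Walk y x := neg nil α

/-- The inverse walk. -/
def inv {x : V} : ∀ {y : V}, Walk x y → Walk y x
  | _, nil => nil
  | _, pos p α => (invArrow α).comp p.inv
  | _, neg p α => (ofArrow α).comp p.inv

/-- A path, seen as a walk. -/
def ofPath {x : V} : ∀ {y : V}, Path x y → Walk x y
  | _, Path.nil => nil
  | _, Path.cons p α => pos (ofPath p) α

theorem comp_nil {x y : V} (u : Walk x y) : u.comp nil = u := rfl

theorem nil_comp {x y : V} (u : Walk x y) : nil.comp u = u := by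
  induction u with
  | nil => rfl
  | pos p α ih => rw [comp, ih]
  | neg p α ih => rw [comp, ih]

theorem comp_assoc {x y z t : V} (u : Walk x y) (v : Walk y z) (w : Walk z t) :
    (u.comp v).comp w = u.comp (v.comp w) := by
  induction w with
  | nil => rfl
  | pos p α ih => rw [comp, comp, comp, ih]
  | neg p α ih => rw [comp, comp, comp, ih]

theorem inv_comp {x y z : V} (u : Walk x y) (v : Walk y z) :
    (u.comp v).inv = v.inv.comp u.inv := by
  induction v with
  | nil => rw [comp_nil, inv, nil_comp]
  | pos p α ih => rw [comp, inv, inv, ih, comp_assoc]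
  | neg p α ih => rw [comp, inv, inv, ih, comp_assoc]

theorem inv_inv {x y : V} (u : Walk x y) : u.inv.inv = u := by
  induction u with
  | nil => rfl
  | pos p α ih => rw [inv, inv_comp, ih]; rfl
  | neg p α ih => rw [inv, inv_comp, ih]; rfl

theorem ofPath_comp {x y z : V} (p : Path x y) (q : Path y z) :
    ofPath (p.comp q) = (ofPath p).comp (ofPath q) := by
  induction q with
  | nil => rfl
  | cons q α ih => rw [Path.comp_cons, ofPath, ofPath, comp, ih]

end Walk

variable [Fintype V]

/-- The homotopy relation `∼_I` on the walks of `Q`: the smallest equivalence relation, compatible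
with concatenation, such that `α⁻¹α` and `αα⁻¹` are homotopic to trivial walks for every arrow `α`,
and such that any two paths that appear in a same minimal relation of `I` are homotopic. -/
inductive Homotopic (I : Ideal (PathAlgebra k V)) : ∀ {x y : V}, Walk x y → Walk x y → Prop
  | refl {x y : V} (u : Walk x y) : Homotopic I u u
  | symm {x y : V} {u v : Walk x y} : Homotopic I u v → Homotopic I v u
  | trans {x y : V} {u v w : Walk x y} : Homotopic I u v → Homotopic I v w → Homotopic I u w
  | inv_mul {x y : V} (α : x ⟶ y) :
      Homotopic I ((Walk.ofArrow α).comp (Walk.invArrow α)) Walk.nil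
  | mul_inv {x y : V} (α : x ⟶ y) :
      Homotopic I ((Walk.invArrow α).comp (Walk.ofArrow α)) Walk.nil
  | congr {x y z t : V} (u : Walk x y) {v v' : Walk y z} (w : Walk z t) :
      Homotopic I v v' → Homotopic I ((u.comp v).comp w) ((u.comp v').comp w)
  | rel {x y : V} (r : PathAlgebra k V) (p q : Path x y) : IsMinimalRelation I r →
      (⟨x, y, p⟩ : AnyPath V) ∈ supp r → (⟨x, y, q⟩ : AnyPath V) ∈ supp r →
      Homotopic I (Walk.ofPath p) (Walk.ofPath q)

variable {I : Ideal (PathAlgebra k V)}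

theorem Homotopic.comp {x y z : V} {u u' : Walk x y} {v v' : Walk y z}
    (h : Homotopic I u u') (h' : Homotopic I v v') : Homotopic I (u.comp v) (u'.comp v') := by
  have a := Homotopic.congr (I := I) Walk.nil v h
  have b := Homotopic.congr (I := I) u' Walk.nil h'
  rw [Walk.nil_comp, Walk.nil_comp] at a
  exact a.trans b

variable (I) in
theorem homotopic_comp_inv {x y : V} (u : Walk x y) : Homotopic I (u.comp u.inv) Walk.nil := by
  induction u with
  | nil => exact .refl _
  | pos p α ih =>
    have h := (Homotopic.congr (I := I) p p.inv (.inv_mul α)).trans ih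
    rwa [Walk.comp_assoc, Walk.comp_assoc, ← Walk.comp_assoc] at h
  | neg p α ih =>
    have h := (Homotopic.congr (I := I) p p.inv (.mul_inv α)).trans ih
    rwa [Walk.comp_assoc, Walk.comp_assoc, ← Walk.comp_assoc] at h

variable (I) in
theorem homotopic_inv_comp {x y : V} (u : Walk x y) : Homotopic I (u.inv.comp u) Walk.nil := by
  have := homotopic_comp_inv I u.inv
  rwa [Walk.inv_inv] at this

theorem Homotopic.inv {x y : V} {u v : Walk x y} (h : Homotopic I u v) :
    Homotopic I u.inv v.inv := by
  have h1 : Homotopic I (u.inv.comp (v.comp v.inv)) u.inv :=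
    (Homotopic.refl u.inv).comp (homotopic_comp_inv I v)
  have h2 : Homotopic I (u.inv.comp (u.comp v.inv)) (u.inv.comp (v.comp v.inv)) :=
    (Homotopic.refl u.inv).comp (h.comp (.refl _))
  have h3 : Homotopic I ((u.inv.comp u).comp v.inv) (Walk.nil.comp v.inv) :=
    (homotopic_inv_comp I u).comp (.refl v.inv)
  rw [Walk.nil_comp, Walk.comp_assoc] at h3
  exact (h1.symm.trans h2.symm).trans h3

variable (I)

/-- Homotopy of closed walks at `x₀`. -/
def homotopySetoid (x₀ : V) : Setoid (Walk x₀ x₀) where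
  r := Homotopic I
  iseqv := ⟨.refl, .symm, .trans⟩

/-- The fundamental group `π₁(Q, I, x₀)`: homotopy classes of closed walks at `x₀`. -/
def FundGroup (x₀ : V) : Type _ := Quotient (homotopySetoid I x₀)

/-- The class `[u]_I` of a closed walk `u`. -/
def FundGroup.mk {x₀ : V} (u : Walk x₀ x₀) : FundGroup I x₀ := Quotient.mk (homotopySetoid I x₀) u

/-- The product `[v][u]` is the class of the walk `vu`, which follows `u` first. -/
instance (x₀ : V) : Group (FundGroup I x₀) where
  mul a b := Quotient.map₂ (sa := homotopySetoid I x₀) (sb := homotopySetoid I x₀)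
    (sc := homotopySetoid I x₀) (fun v u => u.comp v)
    (fun _ _ h _ _ h' => Homotopic.comp h' h) a b
  one := FundGroup.mk I Walk.nil
  inv a := Quotient.map (sa := homotopySetoid I x₀) (sb := homotopySetoid I x₀)
    (fun u => u.inv) (fun _ _ h => Homotopic.inv h) a
  mul_assoc a b c := by
    refine Quotient.inductionOn₃ a b c fun u v w => ?_
    exact congrArg (FundGroup.mk I) (Walk.comp_assoc w v u).symm
  one_mul a := by
    refine Quotient.inductionOn a fun u => ?_
    exact congrArg (FundGroup.mk I) (Walk.comp_nil u)
  mul_one a := by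
    refine Quotient.inductionOn a fun u => ?_
    exact congrArg (FundGroup.mk I) (Walk.nil_comp u)
  inv_mul_cancel a := by
    refine Quotient.inductionOn a fun u => ?_
    exact Quotient.sound (s := homotopySetoid I x₀) (homotopic_comp_inv I u)

theorem FundGroup.mk_mul {x₀ : V} (v u : Walk x₀ x₀) :
    FundGroup.mk I v * FundGroup.mk I u = FundGroup.mk I (u.comp v) := rfl

theorem FundGroup.mk_eq {x₀ : V} {u v : Walk x₀ x₀} (h : Homotopic I u v) :
    FundGroup.mk I u = FundGroup.mk I v := Quotient.sound (s := homotopySetoid I x₀) h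

end Walks

/-! ### Maximal trees -/

section Trees

variable {V : Type v} [Quiver.{w} V]

/-- `T`, a subquiver with the same vertices as `Q`, is a maximal tree: its underlying graph is a
tree. So there are neither loops nor multiple edges, that is, at most one arrow of `T` joins two
vertices, in one of the two directions, and the resulting simple graph is a tree. -/
structure IsMaximalTree (T : WideSubquiver V) : Prop where
  simple : ∀ x y, (T x y).Subsingleton
  oriented : ∀ x y, (T x y).Nonempty → ¬ (T y x).Nonempty
  tree : (SimpleGraph.fromRel fun x y => (T x y).Nonempty).IsTree

/-- All the arrows of the walk lie in `T`. -/
def InTree (T : WideSubquiver V) {x : V} : ∀ {y : V}, Walk x y → Prop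
  | _, Walk.nil => True
  | _, Walk.pos (y := b) (z := c) p α => InTree T p ∧ α ∈ T b c
  | _, Walk.neg (y := b) (z := c) p α => InTree T p ∧ α ∈ T c b

theorem IsMaximalTree.exists_walk {T : WideSubquiver V} (hT : IsMaximalTree T) (x y : V) :
    ∃ γ : Walk x y, InTree T γ ∧ ∀ δ : Walk x y, InTree T δ → γ.length ≤ δ.length := by
  have key : ∃ γ : Walk x y, InTree T γ := by
    obtain ⟨p⟩ := hT.tree.connected.preconnected y x
    induction p with
    | nil => exact ⟨Walk.nil, trivial⟩
    | @cons a b c h p ih =>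
      obtain ⟨γ, hγ⟩ := ih
      rw [SimpleGraph.fromRel_adj] at h
      obtain ⟨-, ⟨α, hα⟩ | ⟨α, hα⟩⟩ := h
      · exact ⟨Walk.neg γ α, hγ, hα⟩
      · exact ⟨Walk.pos γ α, hγ, hα⟩
  obtain ⟨γ, hγ, hmin⟩ := WellFounded.has_min
    (measure fun δ : Walk x y => δ.length).wf {δ | InTree T δ} key
  exact ⟨γ, hγ, fun δ hδ => not_lt.mp (hmin δ hδ)⟩

/-- The walk `γ_x` in the maximal tree `T`, from `x₀` to `x`, of minimal length. -/
def treeWalk {T : WideSubquiver V} (hT : IsMaximalTree T) (x₀ x : V) : Walk x₀ x :=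
  (hT.exists_walk x₀ x).choose

end Trees

/-! ### The algebra -/

section Algebra

variable {k : Type u} [Field k] {A : Type*} [Ring A] [Algebra k A] {V : Type v}

/-- The algebra `A` is connected: it is non-zero and its only central idempotents are `0`, `1`. -/
def IsConnectedAlgebra (A : Type*) [Ring A] : Prop :=
  Nontrivial A ∧ ∀ c : A, c ∈ Subring.center A → IsIdempotentElem c → c = 0 ∨ c = 1

/-- A primitive idempotent: non-zero, and not the sum of two non-zero orthogonal idempotents. -/
def IsPrimitiveIdempotent (a : A) : Prop :=
  IsIdempotentElem a ∧ a ≠ 0 ∧ ∀ f g : A, IsIdempotentElem f → IsIdempotentElem g →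
    f * g = 0 → g * f = 0 → a = f + g → f = 0 ∨ g = 0

/-- `e` is a complete set of primitive orthogonal idempotents. -/
structure IsCompletePrimitive [Fintype V] (e : V → A) : Prop where
  complete : CompleteOrthogonalIdempotents e
  primitive : ∀ x, IsPrimitiveIdempotent (e x)

/-- `A`, with complete set `e` of primitive orthogonal idempotents, is basic: the indecomposable
projective modules `A e_x` are pairwise non-isomorphic. (This is left-right symmetric.) -/
def IsBasic (e : V → A) : Prop :=
  ∀ x y, Nonempty ((Ideal.span {e x} : Ideal A) ≃ₗ[A] (Ideal.span {e y} : Ideal A)) → x = y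

variable (k)

/-- The `k`-subspace `b S a = {b s a | s ∈ S}` of `A`. -/
def corner (b a : A) (S : Submodule k A) : Submodule k A :=
  S.map (LinearMap.mulLeftRight k (b, a))

/-- The radical `𝔯` of `A`, as a subspace. -/
def rad (A : Type*) [Ring A] [Algebra k A] : Submodule k A :=
  (Ring.jacobson A).restrictScalars k

/-- The square `𝔯²` of the radical of `A`, as a subspace. -/
def radSq (A : Type*) [Ring A] [Algebra k A] : Submodule k A :=
  (Ring.jacobson A ^ 2).restrictScalars k

variable {k}

variable (k) in
/-- `Q`, with the index set of `e` as set of vertices, is the ordinary quiver of `A`: the number of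
arrows `x ⟶ y` is finite, equal to the dimension of `e_y (𝔯 / 𝔯²) e_x`. -/
def IsOrdinaryQuiver [Quiver.{w} V] (e : V → A) : Prop :=
  ∀ x y : V, Finite (x ⟶ y) ∧
    Nat.card (x ⟶ y) =
      Module.finrank k ((corner k (e y) (e x) (rad k A)).map (radSq k A).mkQ)

/-- The quiver has no oriented cycles: a path with the same source and target is trivial. -/
def NoOrientedCycles (V : Type v) [Quiver.{w} V] : Prop :=
  ∀ (x : V) (p : Path x x), p = Path.nil

variable (k)

/-- A presentation of `A` by quiver and admissible relations: a surjective algebra homomorphism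
`ν : kQ → A` with admissible kernel and with `ν (e_x) = e_x` for every vertex `x`. -/
structure Presentation [Quiver.{w} V] [Fintype V] (e : V → A) where
  hom : PathAlgebra k V →ₐ[k] A
  surjective : Function.Surjective hom
  admissible : IsAdmissible (RingHom.ker hom)
  map_vertex : ∀ x, hom (vertex k x) = e x

attribute [local instance] LieRing.ofAssociativeRing

variable {k}

variable (k) in
/-- `Der₀(A)`: the Lie algebra of unitary derivations, that is, of the `k`-linear derivations of
`A` that vanish on every `e_x`. -/
def Der0 (e : V → A) : LieSubalgebra k (Module.End k A) where
  carrier := {d | (∀ a b, d (a * b) = a * d b + d a * b) ∧ ∀ x, d (e x) = 0}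
  zero_mem' := ⟨fun a b => by simp, fun x => rfl⟩
  add_mem' := by
    rintro d d' ⟨h1, h2⟩ ⟨h1', h2'⟩
    refine ⟨fun a b => ?_, fun x => ?_⟩
    · simp only [LinearMap.add_apply, h1, h1', mul_add, add_mul]; abel
    · rw [LinearMap.add_apply, h2, h2', add_zero]
  smul_mem' := by
    rintro c d ⟨h1, h2⟩
    refine ⟨fun a b => ?_, fun x => ?_⟩
    · simp only [LinearMap.smul_apply, h1, smul_add, mul_smul_comm, smul_mul_assoc]
    · rw [LinearMap.smul_apply, h2, smul_zero]
  lie_mem' := by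
    rintro d d' ⟨h1, h2⟩ ⟨h1', h2'⟩
    refine ⟨fun a b => ?_, fun x => ?_⟩
    · simp only [Ring.lie_def, LinearMap.sub_apply, Module.End.mul_apply, h1, h1', map_add, mul_sub,
        sub_mul]
      abel
    · simp only [Ring.lie_def, LinearMap.sub_apply, Module.End.mul_apply, h2, h2', map_zero,
        sub_zero]

variable (k) in
/-- The subspace `E` of `A` spanned by the `e_x`. -/
def idemSpan (e : V → A) : Submodule k A := Submodule.span k (Set.range e)

theorem Der0.apply_idemSpan {e : V → A} (d : Der0 k e) {a : A} (ha : a ∈ idemSpan k e) :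
    d.1 a = 0 := by
  induction ha using Submodule.span_induction with
  | mem x h => obtain ⟨y, rfl⟩ := h; exact d.2.2 y
  | zero => exact map_zero _
  | add x y _ _ hx hy => rw [map_add, hx, hy, add_zero]
  | smul c x _ hx => rw [map_smul, hx, smul_zero]

variable (k) in
/-- `Int₀(A)`: the ideal of `Der₀(A)` of the inner derivations `b ↦ a b - b a` with `a ∈ E`. -/
def Int0 (e : V → A) : LieIdeal k (Der0 k e) where
  carrier := {d | ∃ a ∈ idemSpan k e, ∀ b, d.1 b = a * b - b * a}
  zero_mem' := ⟨0, zero_mem _, fun b => by simp⟩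
  add_mem' := by
    rintro d d' ⟨a, ha, h⟩ ⟨a', ha', h'⟩
    refine ⟨a + a', add_mem ha ha', fun b => ?_⟩
    have : (d + d').1 b = d.1 b + d'.1 b := rfl
    rw [this, h, h', add_mul, mul_add]; abel
  smul_mem' := by
    rintro c d ⟨a, ha, h⟩
    refine ⟨c • a, Submodule.smul_mem _ c ha, fun b => ?_⟩
    have : (c • d).1 b = c • d.1 b := rfl
    rw [this, h, smul_sub, smul_mul_assoc, mul_smul_comm]
  lie_mem := by
    rintro d d' ⟨a, ha, h⟩
    refine ⟨0, zero_mem _, fun b => ?_⟩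
    have h0 : d.1 a = 0 := Der0.apply_idemSpan d ha
    have : (⁅d, d'⁆ : Der0 k e).1 b = d.1 (d'.1 b) - d'.1 (d.1 b) := rfl
    rw [this, h, h, map_sub, d.2.1, d.2.1, h0]
    simp

variable (k) in
/-- The Lie algebra `HH¹(A)`, in the form `Der₀(A) / Int₀(A)`. -/
def HH1 (e : V → A) : Type _ := Der0 k e ⧸ Int0 k e

instance (e : V → A) : LieRing (HH1 k e) := inferInstanceAs (LieRing (Der0 k e ⧸ Int0 k e))
instance (e : V → A) : LieAlgebra k (HH1 k e) := inferInstanceAs (LieAlgebra k (Der0 k e ⧸ Int0 k e))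
/-- The class in `HH¹(A)` of a unitary derivation. -/
def HH1.mk {e : V → A} : Der0 k e →ₗ[k] HH1 k e :=
  (LieSubmodule.Quotient.mk' (Int0 k e) : Der0 k e →ₗ[k] Der0 k e ⧸ Int0 k e)

variable (k) in
/-- The bases of `A` that are used for diagonalizability: `k`-bases `B` of `A` contained in the
union of the `e_y A e_x`, that contain every `e_x` and whose other elements lie in the radical. -/
structure IsAdmissibleBasis (e : V → A) (B : Set A) : Prop where
  linearIndependent : LinearIndependent k ((↑) : B → A)
  span_eq : Submodule.span k B = ⊤
  homogeneous : ∀ b ∈ B, ∃ x y, e y * b * e x = b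
  idem_mem : ∀ x, e x ∈ B
  mem_radical : ∀ b ∈ B, b ∉ Set.range e → b ∈ Ring.jacobson A

/-- A linear map is diagonal with respect to `B` if every element of `B` is an eigenvector. -/
def IsDiagonalMap (d : A →ₗ[k] A) (B : Set A) : Prop := ∀ b ∈ B, ∃ t : k, d b = t • b

/-- A class in `HH¹(A)` is diagonal with respect to `B` if it is represented by a derivation that
is diagonal with respect to `B`. -/
def IsDiagonal {e : V → A} (f : HH1 k e) (B : Set A) : Prop :=
  ∃ d : Der0 k e, HH1.mk d = f ∧ IsDiagonalMap d.1 B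

/-- The subset `D` of `HH¹(A)` is diagonalizable: there is one basis with respect to which all
its elements are diagonal. -/
def IsDiagonalizable {e : V → A} (D : Set (HH1 k e)) : Prop :=
  ∃ B : Set A, IsAdmissibleBasis k e B ∧ ∀ f ∈ D, IsDiagonal f B

/-! ### The homomorphism `θ_ν` -/

section Theta

variable [Quiver.{w} V] [Fintype V] {e : V → A}

/-- The closed walk `γ_y⁻¹ u γ_x` at `x₀` attached to a path `u` from `x` to `y`. -/
def closedWalk {T : WideSubquiver V} (hT : IsMaximalTree T) (x₀ : V) (u : AnyPath V) :
    Walk x₀ x₀ :=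
  ((treeWalk hT x₀ u.1).comp (Walk.ofPath u.2.2)).comp (treeWalk hT x₀ u.2.1).inv

/-- The scalar `f([γ_y⁻¹ u γ_x])` attached to a path `u` from `x` to `y` by a group homomorphism
`f : π₁(Q, I, x₀) → k⁺`. -/
def weight {T : WideSubquiver V} (hT : IsMaximalTree T) (x₀ : V) {I : Ideal (PathAlgebra k V)}
    (f : Additive (FundGroup I x₀) →+ k) (u : AnyPath V) : k :=
  f (Additive.ofMul (FundGroup.mk I (closedWalk hT x₀ u)))

/-- The linear map `kQ → kQ` that multiplies each path `u` by a scalar `t u`. -/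
def diagMap (t : AnyPath V → k) : PathAlgebra k V →ₗ[k] PathAlgebra k V :=
  Finsupp.linearCombination k fun u => t u • path k u

theorem diagMap_path (t : AnyPath V → k) (u : AnyPath V) :
    diagMap t (path k u) = t u • path k u :=
  (Finsupp.linearCombination_single k 1 u).trans (one_smul k _)

theorem eq_part (r : PathAlgebra k V) : r = part r (supp r) := by
  refine (Finsupp.sum_single (r : AnyPath V →₀ k)).symm.trans ?_
  refine Finset.sum_congr rfl fun p _ => ?_
  exact ((Finsupp.smul_single (coeff r p) p (1 : k)).trans
    (by rw [smul_eq_mul, mul_one]; rfl)).symm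

theorem coeff_part (r : PathAlgebra k V) (S : Finset (AnyPath V)) (p : AnyPath V) :
    coeff (part r S) p = open Classical in if p ∈ S then coeff r p else 0 := by
  classical
  have h2 : ∀ q, coeffMap p (coeff r q • path k q) = if q = p then coeff r q else 0 := fun q => by
    have : coeffMap p (path k q) = if q = p then (1 : k) else 0 := Finsupp.single_apply
    rw [map_smul, this, smul_eq_mul, mul_ite, mul_one, mul_zero]
  change coeffMap p (part r S) = _
  rw [part, map_sum, Finset.sum_congr rfl fun q _ => h2 q, Finset.sum_ite_eq']

theorem supp_part (r : PathAlgebra k V) (S : Finset (AnyPath V)) (hS : S ⊆ supp r) :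
    supp (part r S) = S := by
  classical
  ext p
  rw [mem_supp, coeff_part]
  split_ifs with h
  · exact iff_of_true ((mem_supp r p).mp (hS h)) h
  · exact iff_of_false (fun h' => h' rfl) h

theorem part_sdiff [DecidableEq (AnyPath V)] (r : PathAlgebra k V) {S : Finset (AnyPath V)}
    (hS : S ⊆ supp r) : r - part r S = part r (supp r \ S) := by
  nth_rewrite 1 [eq_part r]
  rw [sub_eq_iff_eq_add]
  exact (Finset.sum_sdiff hS).symm

/-- A diagonal map that is constant on the support of each minimal relation preserves the ideal,
because the ideal is spanned by its minimal relations. -/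
theorem diagMap_mem {I : Ideal (PathAlgebra k V)} (t : AnyPath V → k)
    (ht : ∀ r, IsMinimalRelation I r → ∀ u ∈ supp r, ∀ v ∈ supp r, t u = t v)
    {r : PathAlgebra k V} (hr : r ∈ I) : diagMap t r ∈ I := by
  classical
  induction hn : (supp r).card using Nat.strong_induction_on generalizing r with
  | _ n ih =>
  by_cases h0 : r = 0
  · rw [h0, map_zero]; exact I.zero_mem
  by_cases hmin : IsMinimalRelation I r
  · obtain ⟨u, hu⟩ : (supp r).Nonempty := Finset.nonempty_iff_ne_empty.mpr fun h =>
      h0 (Finsupp.support_eq_empty.mp h)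
    have : diagMap t r = t u • r := by
      conv_lhs => rw [eq_part r]
      conv_rhs => rw [eq_part r]
      rw [part, map_sum, Finset.smul_sum]
      refine Finset.sum_congr rfl fun v hv => ?_
      rw [map_smul, diagMap_path, ht r hmin v hv u hu, smul_comm]
    rw [this]
    exact Submodule.smul_of_tower_mem I _ hr
  · obtain ⟨S, hS, hSr, hmem⟩ : ∃ S : Finset (AnyPath V), S.Nonempty ∧ S ⊂ supp r ∧
        part r S ∈ I := by
      by_contra hcon
      exact hmin ⟨hr, h0, fun S h1 h2 h3 => hcon ⟨S, h1, h2, h3⟩⟩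
    have h1 := ih _ (hn ▸ Finset.card_lt_card ((supp_part r S hSr.1).symm ▸ hSr)) hmem rfl
    have hd := part_sdiff r hSr.1
    have hmem' : part r (supp r \ S) ∈ I := hd ▸ I.sub_mem hr hmem
    have hlt : supp r \ S ⊂ supp r := Finset.sdiff_ssubset hSr.1 hS
    have h2 := ih _ (hn ▸ Finset.card_lt_card ((supp_part r _ hlt.1).symm ▸ hlt)) hmem' rfl
    have : diagMap t r = diagMap t (part r S) + diagMap t (part r (supp r \ S)) := by
      rw [← map_add, ← hd, add_sub_cancel]
    rw [this]
    exact I.add_mem h1 h2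

/-- The paths that appear in a minimal relation are parallel. -/
theorem IsMinimalRelation.parallel {I : Ideal (PathAlgebra k V)} [I.IsTwoSided]
    {r : PathAlgebra k V} (hr : IsMinimalRelation I r) {u v : AnyPath V} (hu : u ∈ supp r)
    (hv : v ∈ supp r) : v.1 = u.1 ∧ v.2.1 = u.2.1 := by
  classical
  set S := (supp r).filter fun p => p.1 = u.1 ∧ p.2.1 = u.2.1 with hS
  have hSr : S ⊆ supp r := Finset.filter_subset _ _
  have key : vertex k u.2.1 * r * vertex k u.1 = part r S := by
    conv_lhs => rw [eq_part r]
    rw [part, part, Finset.mul_sum, Finset.sum_mul, hS, Finset.sum_filter]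
    refine Finset.sum_congr rfl fun p _ => ?_
    rw [mul_smul_comm, smul_mul_assoc]
    obtain ⟨x, y, p⟩ := p
    split_ifs with h
    · obtain ⟨h1, h2⟩ := h
      simp only at h1 h2
      subst h1 h2
      rw [vertex, vertex, path_mul_comp, path_mul_comp, Path.nil_comp, Path.comp_nil]
    · by_cases h2 : y = u.2.1
      · have h1 : x ≠ u.1 := fun h1 => h ⟨h1, h2⟩
        subst h2
        rw [vertex, vertex, path_mul_comp, path_mul_of_ne (by exact fun h => h1 h.symm), smul_zero]
      · rw [vertex, path_mul_of_ne (by exact h2), zero_mul, smul_zero]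
  have hmem : part r S ∈ I := key ▸ I.mul_mem_right _ (I.mul_mem_left _ hr.1)
  have hne : S.Nonempty := ⟨u, Finset.mem_filter.mpr ⟨hu, rfl, rfl⟩⟩
  have : S = supp r := by
    by_contra h
    exact hr.2.2 S hne (Finset.ssubset_iff_subset_ne.mpr ⟨hSr, h⟩) hmem
  rw [← this, hS] at hv
  exact (Finset.mem_filter.mp hv).2

variable {T : WideSubquiver V} (hT : IsMaximalTree T) (x₀ : V)

theorem weight_eq {I : Ideal (PathAlgebra k V)} [I.IsTwoSided]
    (f : Additive (FundGroup I x₀) →+ k) (r : PathAlgebra k V) (hr : IsMinimalRelation I r)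
    (u : AnyPath V) (hu : u ∈ supp r) (v : AnyPath V) (hv : v ∈ supp r) :
    weight hT x₀ f u = weight hT x₀ f v := by
  obtain ⟨h1, h2⟩ := hr.parallel hu hv
  obtain ⟨x, y, p⟩ := u
  obtain ⟨x', y', q⟩ := v
  simp only at h1 h2
  subst h1 h2
  exact congrArg (fun g => f (Additive.ofMul g))
    (FundGroup.mk_eq I (Homotopic.congr _ _ (Homotopic.rel r p q hr hu hv)))

theorem weight_comp {I : Ideal (PathAlgebra k V)} (f : Additive (FundGroup I x₀) →+ k)
    {x y z : V} (p : Path x y) (q : Path y z) :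
    weight hT x₀ f ⟨x, z, p.comp q⟩ = weight hT x₀ f ⟨y, z, q⟩ + weight hT x₀ f ⟨x, y, p⟩ := by
  rw [weight, weight, weight, ← map_add, ← ofMul_mul, FundGroup.mk_mul]
  refine congrArg (fun g => f (Additive.ofMul g)) (FundGroup.mk_eq I ?_)
  have h := Homotopic.congr ((treeWalk hT x₀ x).comp (Walk.ofPath p))
    ((Walk.ofPath q).comp (treeWalk hT x₀ z).inv) (homotopic_inv_comp I (treeWalk hT x₀ y))
  simp only [closedWalk, Walk.ofPath_comp, Walk.comp_assoc, Walk.nil_comp] at h ⊢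
  exact h.symm

theorem weight_nil {I : Ideal (PathAlgebra k V)} (f : Additive (FundGroup I x₀) →+ k) (x : V) :
    weight hT x₀ f ⟨x, x, Path.nil⟩ = 0 := by
  have h := weight_comp hT x₀ f (Path.nil : Path x x) Path.nil
  rw [Path.comp_nil] at h
  exact left_eq_add.mp h

/-- A diagonal map whose weights are additive on concatenations is a derivation of `kQ`. -/
theorem diagMap_mul (t : AnyPath V → k)
    (ht : ∀ {x y z : V} (p : Path x y) (q : Path y z),
      t ⟨x, z, p.comp q⟩ = t ⟨y, z, q⟩ + t ⟨x, y, p⟩) (a b : PathAlgebra k V) :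
    diagMap t (a * b) = a * diagMap t b + diagMap t a * b := by
  refine lin_ind (p := fun a => diagMap t (a * b) = a * diagMap t b + diagMap t a * b) a
    (by simp) (fun a a' h h' => by rw [add_mul, map_add, h, h', map_add, add_mul, add_mul]; abel)
    fun c q => ?_
  refine lin_ind (p := fun b => diagMap t (c • path k q * b) =
      c • path k q * diagMap t b + diagMap t (c • path k q) * b) b
    (by simp) (fun a a' h h' => by rw [mul_add, map_add, h, h', map_add, mul_add, mul_add]; abel)
    fun d p => ?_
  obtain ⟨y', z, q⟩ := q
  obtain ⟨x, y, p⟩ := p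
  simp only [smul_mul_assoc, mul_smul_comm, map_smul, diagMap_path]
  by_cases h : y = y'
  · subst h
    rw [path_mul_comp, diagMap_path, ht, add_smul]
    simp only [smul_add]
    rw [add_comm]
    congr 1
    rw [smul_comm c (t _)]
  · rw [path_mul_of_ne (by exact h)]
    simp

/-- The linear map `f̃ : A → A` such that `f̃ (ν u) = f([γ_y⁻¹ u γ_x]) ν u` for any path `u` from
`x` to `y`. -/
def Presentation.tilde (ν : Presentation k e) (f : Additive (FundGroup (RingHom.ker ν.hom) x₀) →+ k) :
    Module.End k A :=
  (Submodule.liftQ (LinearMap.ker ν.hom.toLinearMap)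
    (ν.hom.toLinearMap ∘ₗ diagMap (weight hT x₀ f))
    (fun _ ha => diagMap_mem (weight hT x₀ f) (weight_eq hT x₀ f) ha)) ∘ₗ
    (LinearMap.quotKerEquivOfSurjective ν.hom.toLinearMap ν.surjective).symm.toLinearMap

theorem Presentation.tilde_hom (ν : Presentation k e)
    (f : Additive (FundGroup (RingHom.ker ν.hom) x₀) →+ k) (a : PathAlgebra k V) :
    ν.tilde hT x₀ f (ν.hom a) = ν.hom (diagMap (weight hT x₀ f) a) := by
  have h : (LinearMap.quotKerEquivOfSurjective ν.hom.toLinearMap ν.surjective).symm (ν.hom a) =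
      Submodule.Quotient.mk a := by
    rw [LinearEquiv.symm_apply_eq]; rfl
  rw [tilde, LinearMap.comp_apply, LinearEquiv.coe_coe, h]
  rfl

/-- The characterization of `f̃` on paths. -/
theorem Presentation.tilde_path (ν : Presentation k e)
    (f : Additive (FundGroup (RingHom.ker ν.hom) x₀) →+ k) (u : AnyPath V) :
    ν.tilde hT x₀ f (ν.hom (path k u)) = weight hT x₀ f u • ν.hom (path k u) := by
  rw [tilde_hom, diagMap_path, map_smul]

theorem Presentation.tilde_mem (ν : Presentation k e)
    (f : Additive (FundGroup (RingHom.ker ν.hom) x₀) →+ k) :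
    ν.tilde hT x₀ f ∈ Der0 k e := by
  refine ⟨fun a b => ?_, fun x => ?_⟩
  · obtain ⟨a, rfl⟩ := ν.surjective a
    obtain ⟨b, rfl⟩ := ν.surjective b
    rw [← map_mul, tilde_hom, tilde_hom, tilde_hom, diagMap_mul _ (weight_comp hT x₀ f), map_add,
      map_mul, map_mul]
  · rw [← ν.map_vertex, vertex, tilde_path, weight_nil, zero_smul]

/-- The homomorphism of abelian groups `θ_ν : Hom(π₁(Q, Ker ν), k⁺) → HH¹(A)`, `f ↦ [f̃]`. -/
def Presentation.theta (ν : Presentation k e) :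
    (Additive (FundGroup (RingHom.ker ν.hom) x₀) →+ k) →+ HH1 k e :=
  AddMonoidHom.mk' (fun f => HH1.mk ⟨ν.tilde hT x₀ f, ν.tilde_mem hT x₀ f⟩) fun f g => by
    rw [← map_add]
    congr 1
    refine Subtype.ext (LinearMap.ext fun a => ?_)
    obtain ⟨a, rfl⟩ := ν.surjective a
    change ν.tilde hT x₀ (f + g) (ν.hom a) =
      ν.tilde hT x₀ f (ν.hom a) + ν.tilde hT x₀ g (ν.hom a)
    rw [ν.tilde_hom, ν.tilde_hom, ν.tilde_hom, ← map_add]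
    congr 1
    have : diagMap (weight hT x₀ (f + g)) =
        diagMap (weight hT x₀ f) + diagMap (weight hT x₀ g) := lin_ext fun p => by
      rw [LinearMap.add_apply, diagMap_path, diagMap_path, diagMap_path, ← add_smul]
      rfl
    rw [this, LinearMap.add_apply]

end Theta

end Algebra
end BoundQuiver

end

noncomputable section

namespace BoundQuiver

open Quiver

universe u v w

/-! ### Powers of the arrow ideal -/

section ArrowIdeal

variable {k : Type u} [Field k] {V : Type v} [Quiver.{w} V]

/-! Fix a presentation `ν`. The images of the paths span `A`, lie in the corners `e_y A e_x`, and
are eigenvectors of every derivation `f̃`. Non-trivial paths land in the radical because the kernel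
contains a power of the arrow ideal. Extending the independent family of the `e_x` by path images
therefore gives one suitable basis that diagonalizes all of `Im θ_ν`
(`exists_isAdmissibleBasis_subset`).

Conversely, let `B` be a suitable basis. The elements of `B` in the radical part of `e_y A e_x` span
`e_y (𝔯/𝔯²) e_x`, so some of them represent a basis of it, and there are as many of these as arrows
from `x` to `y`. Sending arrows to them defines a presentation `ν` with all arrows in `B`
(`exists_presentation`). It depends on `B` alone, so it serves every element of `D` at once.

A derivation `d` diagonal on `B` scales each arrow `α` by some `t α`, hence by Leibniz each path by
the sum of the weights of its arrows. The corresponding diagonal operator on `kQ` preserves `Ker ν`.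
A polynomial in this operator projects a relation onto one eigenspace, so by minimality the weight
is constant on each minimal relation (`weight_eq_of_diagMap_mem`). Signed weights of walks are thus
homotopy invariant and define `f : π₁ → k⁺`. On a path from `x` to `y`, `f̃` and `d` differ by the
factor `c x - c y`, where `c x` is the weight of the tree walk `γ_x`. This difference is inner, so
`θ_ν f` is the class of `d` (`mk_mem_range_theta`). -/

theorem path_cons {x y z : V} (p : Path x y) (α : y ⟶ z) :
    path k ⟨x, z, p.cons α⟩ = arrow k α * path k ⟨x, y, p⟩ :=
  (path_mul_comp p α.toPath).symm

variable [Fintype V]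

instance arrowIdeal_isTwoSided : (arrowIdeal k V).IsTwoSided :=
  inferInstanceAs (TwoSidedIdeal.asIdeal _).IsTwoSided

theorem arrow_mem_arrowIdeal {x y : V} (α : x ⟶ y) : arrow k α ∈ arrowIdeal k V :=
  TwoSidedIdeal.mem_asIdeal.2 (TwoSidedIdeal.subset_span ⟨x, y, α, rfl⟩)

theorem path_cons_mem_arrowIdeal {x y z : V} (p : Path x y) (α : y ⟶ z) :
    path k ⟨x, z, p.cons α⟩ ∈ arrowIdeal k V := by
  rw [path_cons]
  exact (arrowIdeal k V).mul_mem_right _ (arrow_mem_arrowIdeal α)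

theorem path_cons_cons_mem_arrowIdeal_sq {x y z t : V} (p : Path x y) (α : y ⟶ z) (β : z ⟶ t) :
    path k ⟨x, t, (p.cons α).cons β⟩ ∈ arrowIdeal k V ^ 2 := by
  rw [path_cons, Submodule.pow_succ, Submodule.pow_one]
  exact Ideal.mul_mem_mul (arrow_mem_arrowIdeal β) (path_cons_mem_arrowIdeal p α)

/-- The preimage of `J` is a two-sided ideal containing the arrows, hence the whole arrow ideal;
powers follow by multiplicativity. Both halves of admissibility use this with `J` the radical. -/
theorem map_mem_pow_of_mem_arrowIdeal_pow {A : Type*} [Ring A] (φ : PathAlgebra k V →+* A)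
    (J : Ideal A) [J.IsTwoSided] (h : ∀ (x y : V) (α : x ⟶ y), φ (arrow k α) ∈ J) (n : ℕ)
    {a : PathAlgebra k V} (ha : a ∈ arrowIdeal k V ^ n) : φ a ∈ J ^ n := by
  have h1 : arrowIdeal k V ≤ J.comap φ := fun a ha => by
    have hle : TwoSidedIdeal.span {a | ∃ (x y : V) (α : x ⟶ y), a = arrow k α} ≤
        (J.comap φ).toTwoSided := TwoSidedIdeal.span_le.2 (by
      rintro _ ⟨x, y, α, rfl⟩
      exact Ideal.mem_toTwoSided.2 (h x y α))
    exact Ideal.mem_toTwoSided.1 (hle (TwoSidedIdeal.mem_asIdeal.1 ha))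
  suffices hn : arrowIdeal k V ^ n ≤ (J ^ n).comap φ from hn ha
  clear ha
  induction n with
  | zero => simp only [Submodule.pow_zero, Ideal.one_eq_top, Ideal.comap_top, le_refl]
  | succ n ih =>
    rw [Submodule.pow_succ, Submodule.pow_succ, Ideal.mul_le]
    intro r hr s hs
    rw [Ideal.mem_comap, map_mul]
    exact Ideal.mul_mem_mul (ih hr) (h1 hs)

end ArrowIdeal

/-! ### The radical and the idempotents -/

section Radical

variable {A : Type*} [Ring A]

/-- Each `y * x + 1` is a unit, being a nilpotent plus one, so `x` is left quasi-regular. -/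
theorem mem_jacobson_of_isNilpotent_mul {x : A} (h : ∀ y, IsNilpotent (y * x)) :
    x ∈ Ring.jacobson A := by
  rw [← Ideal.jacobson_bot, Ideal.mem_jacobson_iff]
  intro y
  obtain ⟨z, hz⟩ := (h y).isUnit_add_one.exists_left_inv
  refine ⟨z, ?_⟩
  rw [Ideal.mem_bot, ← hz]
  noncomm_ring

theorem eq_zero_of_isIdempotentElem_of_mem_jacobson {a : A} (ha : IsIdempotentElem a)
    (h : a ∈ Ring.jacobson A) : a = 0 := by
  rw [← Ideal.jacobson_bot, Ideal.mem_jacobson_iff] at h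
  -- With `-1`, `z` is a left inverse of `1 - a`. Since `(1 - a) * a = 0`, multiplying by `a` on the
  -- right gives `a = 0`.
  obtain ⟨z, hz⟩ := h (-1)
  rw [Ideal.mem_bot, sub_eq_zero] at hz
  have := congrArg (· * a) hz
  simpa [add_mul, mul_assoc, ha.eq] using this.symm

theorem isNilpotent_jacobson_of_finiteDimensional (k : Type u) [Field k] [Algebra k A]
    [FiniteDimensional k A] : IsNilpotent (Ring.jacobson A) :=
  have := IsArtinianRing.of_finite k A
  IsSemiprimaryRing.isNilpotent

variable {k : Type u} [Field k] [Algebra k A] {V : Type v} [Fintype V] {e : V → A}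

theorem mul_sum_smul (he : OrthogonalIdempotents e) (c : V → k) (x : V) :
    e x * ∑ y, c y • e y = c x • e x := by
  rw [Finset.mul_sum, Finset.sum_eq_single x]
  · rw [mul_smul_comm, (he.idem x).eq]
  · intro y _ hy
    rw [mul_smul_comm, he.ortho hy.symm, smul_zero]
  · simp

theorem IsCompletePrimitive.ne_zero (he : IsCompletePrimitive e) (x : V) : e x ≠ 0 :=
  (he.primitive x).2.1

/-- Multiplying by `e x` isolates `c x • e x` in the radical. If `c x` were non-zero, the non-zero
idempotent `e x` would lie there too. -/
theorem IsCompletePrimitive.eq_zero_of_sum_mem_jacobson (he : IsCompletePrimitive e) {c : V → k}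
    (h : ∑ x, c x • e x ∈ Ring.jacobson A) (x : V) : c x = 0 := by
  by_contra hc
  have h1 : c x • e x ∈ Ring.jacobson A :=
    mul_sum_smul he.complete.1 c x ▸ Ideal.mul_mem_left _ (e x) h
  have h2 := Submodule.smul_of_tower_mem (Ring.jacobson A) (c x)⁻¹ h1
  rw [smul_smul, inv_mul_cancel₀ hc, one_smul] at h2
  exact he.ne_zero x (eq_zero_of_isIdempotentElem_of_mem_jacobson (he.complete.idem x) h2)

theorem IsCompletePrimitive.linearIndependent (he : IsCompletePrimitive e) :
    LinearIndependent k e :=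
  Fintype.linearIndependent_iff.2 fun _ hc =>
    he.eq_zero_of_sum_mem_jacobson (hc ▸ Submodule.zero_mem _)

end Radical

/-! ### The image of `θ_ν` is diagonalizable -/

section Image

variable {k : Type u} [Field k] {A : Type*} [Ring A] [Algebra k A] {V : Type v}
  [Quiver.{w} V] [Fintype V] {e : V → A}

/-- Any multiple of `ν a` lifts to the arrow ideal, whose `N`-th power is in the kernel, so it is
nilpotent. -/
theorem Presentation.hom_mem_jacobson (ν : Presentation k e) {a : PathAlgebra k V}
    (ha : a ∈ arrowIdeal k V) : ν.hom a ∈ Ring.jacobson A := by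
  obtain ⟨N, -, hN, -⟩ := ν.admissible
  refine mem_jacobson_of_isNilpotent_mul fun y => ⟨N, ?_⟩
  obtain ⟨b, rfl⟩ := ν.surjective y
  rw [← map_mul, ← map_pow]
  exact hN (Ideal.pow_mem_pow (Ideal.mul_mem_left _ b ha) N)

theorem span_range_path : Submodule.span k (Set.range (path k (V := V))) = ⊤ := by
  refine eq_top_iff.2 fun a _ => ?_
  rw [eq_part a]
  exact Submodule.sum_mem _ fun p _ => Submodule.smul_mem _ _ (Submodule.subset_span ⟨p, rfl⟩)

/-- The images of the trivial paths are the independent `e x`, which extend to a basis inside the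
spanning set of all path images. Homogeneity and membership in the radical are then properties of
paths. -/
theorem Presentation.exists_isAdmissibleBasis_subset (ν : Presentation k e)
    (he : IsCompletePrimitive e) :
    ∃ B : Set A, IsAdmissibleBasis k e B ∧ B ⊆ Set.range fun u => ν.hom (path k u) := by
  set s : Set A := Set.range fun u => ν.hom (path k u) with hs
  have hes : Set.range e ⊆ s := by
    rintro _ ⟨x, rfl⟩
    exact ⟨⟨x, x, Path.nil⟩, ν.map_vertex x⟩
  have hli : LinearIndepOn k id (Set.range e) := (he.linearIndependent (k := k)).linearIndepOn_id
  have hBs : hli.extend hes ⊆ s := hli.extend_subset hes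
  have hspan : Submodule.span k s = ⊤ := by
    have : s = ν.hom.toLinearMap '' Set.range (path k (V := V)) := by
      rw [hs, ← Set.range_comp]; rfl
    rw [this, Submodule.span_image, span_range_path, Submodule.map_top,
      LinearMap.range_eq_top.2 ν.surjective]
  refine ⟨hli.extend hes, ⟨hli.linearIndepOn_extend hes, ?_, ?_, ?_, ?_⟩, hBs⟩
  · exact (hli.span_extend_eq_span hes).trans hspan
  · intro b hb
    obtain ⟨⟨x, y, p⟩, rfl⟩ := hBs hb
    refine ⟨x, y, ?_⟩
    change e y * ν.hom (path k ⟨x, y, p⟩) * e x = ν.hom (path k ⟨x, y, p⟩)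
    rw [← ν.map_vertex, ← ν.map_vertex, ← map_mul, ← map_mul, vertex, vertex, path_mul_comp,
      path_mul_comp, Path.nil_comp, Path.comp_nil]
  · exact fun x => hli.subset_extend hes ⟨x, rfl⟩
  · intro b hb hbe
    obtain ⟨⟨x, y, p⟩, rfl⟩ := hBs hb
    cases p with
    | nil => exact absurd ⟨x, (ν.map_vertex x).symm⟩ hbe
    | cons p α => exact ν.hom_mem_jacobson (path_cons_mem_arrowIdeal p α)

theorem Presentation.isDiagonalizable_range_theta (ν : Presentation k e)
    (he : IsCompletePrimitive e) {T : WideSubquiver V} (hT : IsMaximalTree T) (x₀ : V) :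
    IsDiagonalizable (Set.range (ν.theta hT x₀)) := by
  obtain ⟨B, hB, hBs⟩ := ν.exists_isAdmissibleBasis_subset he
  refine ⟨B, hB, ?_⟩
  rintro _ ⟨f, rfl⟩
  refine ⟨⟨ν.tilde hT x₀ f, ν.tilde_mem hT x₀ f⟩, rfl, fun b hb => ?_⟩
  obtain ⟨u, rfl⟩ := hBs hb
  exact ⟨_, ν.tilde_path hT x₀ f u⟩

end Image

/-! ### Algebra homomorphisms out of the path algebra -/

section Lift

variable {k : Type u} [Field k] {A : Type*} [Ring A] [Algebra k A] {V : Type v}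
  [Quiver.{w} V]

/-- The product in `A` of the elements attached to the arrows of a path. -/
def pathEval (e : V → A) (β : ∀ x y : V, (x ⟶ y) → A) {x : V} : ∀ {y : V}, Path x y → A
  | _, Path.nil => e x
  | _, Path.cons p α => β _ _ α * pathEval e β p

variable (k) in
/-- The linear extension of `pathEval` to `kQ`. -/
def evalMap (e : V → A) (β : ∀ x y : V, (x ⟶ y) → A) : PathAlgebra k V →ₗ[k] A :=
  Finsupp.linearCombination k fun u : AnyPath V => pathEval e β u.2.2

theorem evalMap_path (e : V → A) (β : ∀ x y : V, (x ⟶ y) → A) (u : AnyPath V) :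
    evalMap k e β (path k u) = pathEval e β u.2.2 :=
  (Finsupp.linearCombination_single k 1 u).trans (one_smul k _)

variable {e : V → A} {β : ∀ x y : V, (x ⟶ y) → A}

theorem mul_pathEval (he : OrthogonalIdempotents e)
    (hβ : ∀ x y (α : x ⟶ y), e y * β x y α * e x = β x y α) {x y : V} (p : Path x y) :
    e y * pathEval e β p = pathEval e β p := by
  cases p with
  | nil => exact (he.idem x).eq
  | cons p α => rw [pathEval, ← hβ, ← mul_assoc, ← mul_assoc, ← mul_assoc, (he.idem y).eq]

theorem pathEval_mul (he : OrthogonalIdempotents e) {x y : V} (p : Path x y) :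
    pathEval e β p * e x = pathEval e β p := by
  induction p with
  | nil => exact (he.idem x).eq
  | cons p α ih => rw [pathEval, mul_assoc, ih]

theorem pathEval_comp (he : OrthogonalIdempotents e)
    (hβ : ∀ x y (α : x ⟶ y), e y * β x y α * e x = β x y α) {x y z : V} (p : Path x y)
    (q : Path y z) : pathEval e β (p.comp q) = pathEval e β q * pathEval e β p := by
  induction q with
  | nil => rw [Path.comp_nil, pathEval, mul_pathEval he hβ]
  | cons q α ih => rw [Path.comp_cons, pathEval, pathEval, ih, mul_assoc]

theorem evalMap_mul (he : OrthogonalIdempotents e)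
    (hβ : ∀ x y (α : x ⟶ y), e y * β x y α * e x = β x y α) (a b : PathAlgebra k V) :
    evalMap k e β (a * b) = evalMap k e β a * evalMap k e β b := by
  refine lin_ind (p := fun a => evalMap k e β (a * b) = evalMap k e β a * evalMap k e β b) a
    (by simp) (fun a a' h h' => by rw [add_mul, map_add, map_add, h, h', add_mul]) fun c q => ?_
  refine lin_ind (p := fun b => evalMap k e β (c • path k q * b) =
    evalMap k e β (c • path k q) * evalMap k e β b) b
    (by simp) (fun a a' h h' => by rw [mul_add, map_add, map_add, h, h', mul_add]) fun d p => ?_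
  obtain ⟨y', z, q⟩ := q
  obtain ⟨x, y, p⟩ := p
  have hs : (c • path k ⟨y', z, q⟩ : PathAlgebra k V) * d • path k ⟨x, y, p⟩ =
      d • c • (path k ⟨y', z, q⟩ * path k ⟨x, y, p⟩) := by
    simp only [mul_def, map_smul, LinearMap.smul_apply]
  rw [hs]
  simp only [map_smul, smul_mul_assoc, mul_smul_comm, evalMap_path]
  by_cases h : y = y'
  · subst h
    rw [path_mul_comp, evalMap_path, pathEval_comp he hβ]
  -- Non-composable paths: the idempotents at the two distinct middle vertices can be inserted
  -- between the factors, and they are orthogonal.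
  · rw [path_mul_of_ne (by exact h), map_zero, ← pathEval_mul he q, mul_assoc,
      ← mul_pathEval he hβ p, ← mul_assoc (e y'), he.ortho (Ne.symm h), zero_mul, mul_zero]

/-- The algebra homomorphism `kQ → A` that sends `e_x` to `e x` and an arrow `α` to `β α`. -/
def evalHom [Fintype V] (he : CompleteOrthogonalIdempotents e)
    (hβ : ∀ x y (α : x ⟶ y), e y * β x y α * e x = β x y α) : PathAlgebra k V →ₐ[k] A :=
  AlgHom.ofLinearMap (evalMap k e β)
    (by
      rw [one_def, map_sum, ← he.complete]
      exact Finset.sum_congr rfl fun x _ => evalMap_path e β _)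
    (evalMap_mul he.1 hβ)

variable [Fintype V] (he : CompleteOrthogonalIdempotents e)
    (hβ : ∀ x y (α : x ⟶ y), e y * β x y α * e x = β x y α)

theorem evalHom_vertex (x : V) : evalHom (k := k) he hβ (vertex k x) = e x :=
  evalMap_path e β _

theorem evalHom_arrow {x y : V} (α : x ⟶ y) : evalHom (k := k) he hβ (arrow k α) = β x y α := by
  refine (evalMap_path e β _).trans ?_
  change β x y α * e x = β x y α
  rw [← hβ, mul_assoc, (he.idem x).eq]

end Lift

/-! ### Generators of the radical inside a basis -/

section Generators

variable {k : Type u} [Field k] {A : Type*} [Ring A] [Algebra k A] {V : Type v} [Fintype V]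
  {e : V → A} {B : Set A}

theorem IsAdmissibleBasis.span_idem_sup (hB : IsAdmissibleBasis k e B) (a : A) :
    ∃ c : V → k, ∃ m ∈ Submodule.span k (B \ Set.range e), m ∈ Ring.jacobson A ∧
      a = ∑ x, c x • e x + m := by
  have ha : a ∈ Submodule.span k (Set.range e ∪ B \ Set.range e) := by
    rw [Set.union_sdiff_self]
    exact Submodule.span_mono Set.subset_union_right (hB.span_eq ▸ Submodule.mem_top)
  rw [Submodule.span_union, Submodule.mem_sup] at ha
  obtain ⟨s, hs, m, hm, rfl⟩ := ha
  obtain ⟨c, rfl⟩ := (Submodule.mem_span_range_iff_exists_fun k).1 hs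
  refine ⟨c, m, hm, ?_, rfl⟩
  exact (Submodule.span_le (p := rad k A)).2 (fun b hb => hB.mem_radical b hb.1 hb.2) hm

/-- The idempotent component of a radical element differs from it by a radical element, so it is
itself radical and vanishes. -/
theorem IsAdmissibleBasis.rad_le_span (hB : IsAdmissibleBasis k e B)
    (he : IsCompletePrimitive e) : rad k A ≤ Submodule.span k (B \ Set.range e) := by
  intro a ha
  obtain ⟨c, m, hm, hmJ, rfl⟩ := hB.span_idem_sup a
  have hc := he.eq_zero_of_sum_mem_jacobson
    ((Submodule.add_mem_iff_left _ hmJ).1 (show _ ∈ Ring.jacobson A from ha))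
  simpa [hc] using hm

theorem mem_corner {b a z : A} {S : Submodule k A} : z ∈ corner k b a S ↔ ∃ s ∈ S, b * s * a = z :=
  Iff.rfl

/-- By homogeneity, `b ↦ e y * b * e x` either fixes a basis element or kills it. -/
theorem IsAdmissibleBasis.corner_rad_le_span (hB : IsAdmissibleBasis k e B)
    (he : IsCompletePrimitive e) (x y : V) : corner k (e y) (e x) (rad k A) ≤
      Submodule.span k {b | b ∈ B \ Set.range e ∧ e y * b * e x = b} := by
  refine (Submodule.map_mono (hB.rad_le_span he)).trans ?_
  rw [Submodule.map_span_le]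
  intro b hb
  change e y * b * e x ∈ _
  obtain ⟨x', y', h⟩ := hB.homogeneous b hb.1
  by_cases hy : y = y'
  · subst hy
    by_cases hx : x' = x
    · subst hx
      exact h.symm ▸ Submodule.subset_span ⟨hb, h⟩
    · rw [mul_assoc, show b * e x = 0 by rw [← h, mul_assoc, he.complete.ortho hx, mul_zero],
        mul_zero]
      exact Submodule.zero_mem _
  · rw [← h, ← mul_assoc, ← mul_assoc, he.complete.ortho hy, zero_mul, zero_mul, zero_mul]
    exact Submodule.zero_mem _

/-- The classes modulo `𝔯²` of the basis elements in the corner span `e_y (𝔯/𝔯²) e_x`. A maximal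
independent subfamily has as many members as there are arrows, by definition of the ordinary quiver,
and is re-indexed by them. -/
theorem IsAdmissibleBasis.exists_arrow_elements [Quiver.{w} V] [FiniteDimensional k A]
    (hB : IsAdmissibleBasis k e B) (he : IsCompletePrimitive e) (hQ : IsOrdinaryQuiver k e)
    (x y : V) :
    ∃ β : (x ⟶ y) → A, (∀ α, β α ∈ B \ Set.range e ∧ e y * β α * e x = β α) ∧
      LinearIndependent k ((radSq k A).mkQ ∘ β) ∧
      corner k (e y) (e x) (rad k A) ≤ radSq k A ⊔ Submodule.span k (Set.range β) := by
  set s : Set A := {b | b ∈ B \ Set.range e ∧ e y * b * e x = b}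
  set W := (corner k (e y) (e x) (rad k A)).map (radSq k A).mkQ with hW
  have hspan : Submodule.span k (Set.range ((radSq k A).mkQ ∘ ((↑) : s → A))) = W := by
    rw [Set.range_comp, Subtype.range_coe, ← Submodule.map_span]
    refine le_antisymm (Submodule.map_mono ?_)
      (Submodule.map_mono (hB.corner_rad_le_span he x y))
    rw [Submodule.span_le]
    exact fun b hb => ⟨b, hB.mem_radical b hb.1.1 hb.1.2, hb.2⟩
  obtain ⟨κ, a, -, ha, hli⟩ := exists_linearIndependent' k ((radSq k A).mkQ ∘ ((↑) : s → A))
  have : Finite κ := hli.finite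
  have := Fintype.ofFinite κ
  have := (hQ x y).1
  have hcard : Nat.card (x ⟶ y) = Nat.card κ := by
    rw [(hQ x y).2, Nat.card_eq_fintype_card, ← finrank_span_eq_card hli, ha, hspan]
  let φ : (x ⟶ y) ≃ κ :=
    (Finite.equivFin _).trans ((finCongr hcard).trans (Finite.equivFin κ).symm)
  refine ⟨fun α => a (φ α), fun α => (a (φ α)).2, hli.comp φ φ.injective, ?_⟩
  -- Containment up to `𝔯²` is containment of images in `A/𝔯²`, where the chosen classes span.
  rw [← Submodule.comap_map_mkQ, ← Submodule.map_le_iff_le_comap, ← hW, ← hspan, ← ha,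
    Submodule.map_span, Submodule.span_le]
  rintro _ ⟨i, rfl⟩
  refine Submodule.subset_span ⟨_, ⟨φ.symm i, rfl⟩, ?_⟩
  simp

/-- A subalgebra that contains the radical modulo its square contains the radical modulo any of its
powers. -/
theorem exists_mem_sub_mem_jacobson_pow (S : Subalgebra k A)
    (h : ∀ a ∈ Ring.jacobson A, ∃ s ∈ S, a - s ∈ Ring.jacobson A ^ 2) (n : ℕ) {a : A}
    (ha : a ∈ Ring.jacobson A) : ∃ s ∈ S, a - s ∈ Ring.jacobson A ^ (n + 1) := by
  set J := Ring.jacobson A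
  have hpow : ∀ m, J ^ (m + 1) ≤ J := fun m => by
    rw [Submodule.pow_succ]; exact Ideal.mul_le_right
  induction n generalizing a with
  | zero => exact ⟨0, S.zero_mem, by rwa [sub_zero, zero_add, Submodule.pow_one]⟩
  | succ n ih =>
    -- The error of the given approximation lies in `J ^ 2`. Approximating both factors of a product
    -- modulo `J ^ (n + 1)` approximates the product modulo `J ^ (n + 2)`.
    suffices key : ∀ b ∈ J ^ 2, ∃ s ∈ S, b - s ∈ J ^ (n + 2) by
      obtain ⟨s, hs, hs'⟩ := h a ha
      obtain ⟨s', hs1, hs2⟩ := key _ hs'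
      exact ⟨s + s', S.add_mem hs hs1, by rwa [← sub_sub]⟩
    intro b hb
    rw [Submodule.pow_succ, Submodule.pow_one] at hb
    refine Submodule.smul_induction_on (p := fun b => ∃ s ∈ S, b - s ∈ J ^ (n + 2)) hb ?_ ?_
    · intro x hx y hy
      obtain ⟨s, hs, hxs⟩ := ih hx
      obtain ⟨t, ht, hyt⟩ := ih hy
      refine ⟨s * t, S.mul_mem hs ht, ?_⟩
      have h1 : (x - s) * y ∈ J ^ (n + 2) := by
        rw [Submodule.pow_succ]; exact Ideal.mul_mem_mul hxs hy
      -- The approximant `s` must itself be radical for `s * (y - t)` to gain one power of `J`.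
      have hsJ : s ∈ J := (sub_sub_cancel x s) ▸ J.sub_mem hx (hpow n hxs)
      have h2 : s * (y - t) ∈ J ^ (n + 2) := by
        rw [Ideal.IsTwoSided.pow_succ]; exact Ideal.mul_mem_mul hsJ hyt
      have : x • y - s * t = (x - s) * y + s * (y - t) := by rw [smul_eq_mul]; noncomm_ring
      rw [this]
      exact Ideal.add_mem _ h1 h2
    · rintro x y ⟨s, hs, hxs⟩ ⟨t, ht, hyt⟩
      exact ⟨s + t, S.add_mem hs ht, by rw [add_sub_add_comm]; exact Ideal.add_mem _ hxs hyt⟩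

end Generators

/-! ### The presentation attached to a basis -/

section ExistsPresentation

variable {k : Type u} [Field k] {A : Type*} [Ring A] [Algebra k A] {V : Type v}
  [Quiver.{w} V] [Fintype V] {e : V → A}

/-- Modulo the square of the arrow ideal, `kQ` is spanned by the trivial paths and the arrows. -/
theorem exists_sub_mem_arrowIdeal_sq [∀ x y : V, Fintype (x ⟶ y)] (a : PathAlgebra k V) :
    ∃ (c : V → k) (t : ∀ x y : V, (x ⟶ y) → k),
      a - (∑ x, c x • vertex k x + ∑ x, ∑ y, ∑ α : x ⟶ y, t x y α • arrow k α) ∈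
        arrowIdeal k V ^ 2 := by
  classical
  refine lin_ind (p := fun a => ∃ (c : V → k) (t : ∀ x y : V, (x ⟶ y) → k),
      a - (∑ x, c x • vertex k x + ∑ x, ∑ y, ∑ α : x ⟶ y, t x y α • arrow k α) ∈
        arrowIdeal k V ^ 2) a ⟨0, 0, by simp⟩ ?_ ?_
  · rintro a a' ⟨c, t, h⟩ ⟨c', t', h'⟩
    refine ⟨c + c', t + t', ?_⟩
    convert Ideal.add_mem _ h h' using 1
    simp only [Pi.add_apply, add_smul, Finset.sum_add_distrib]
    abel
  · rintro r ⟨x, y, p⟩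
    match p with
    | .nil =>
      refine ⟨Pi.single x r, 0, ?_⟩
      convert Ideal.zero_mem _ using 1
      rw [Finset.sum_eq_single x]
      · simp [vertex]
      · intro z _ hz
        rw [Pi.single_eq_of_ne hz, zero_smul]
      · simp
    | .cons .nil α =>
      refine ⟨0, Pi.single x (Pi.single y (Pi.single α r)), ?_⟩
      convert Ideal.zero_mem _ using 1
      simp only [Pi.zero_apply, zero_smul, Finset.sum_const_zero, zero_add]
      rw [Finset.sum_eq_single (s := Finset.univ) x, Finset.sum_eq_single (s := Finset.univ) y,
        Finset.sum_eq_single (s := Finset.univ) α]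
      · simp [arrow, Hom.toPath]
      · intro α' _ hα
        simp [hα]
      · simp
      · intro z _ hz
        simp [hz]
      · simp
      · intro z _ hz
        simp [hz]
      · simp
    | .cons (.cons p β) α =>
      refine ⟨0, 0, ?_⟩
      have := Submodule.smul_of_tower_mem (arrowIdeal k V ^ 2) r
        (path_cons_cons_mem_arrowIdeal_sq (k := k) p β α)
      simpa using this

/-- Sandwiching the sum between `e y` and `e x` leaves only the arrows from `x` to `y` and stays in
`𝔯²`, so independence in a single corner suffices. -/
theorem sum_smul_eq_zero_of_mem_radSq (he : CompleteOrthogonalIdempotents e)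
    [∀ x y : V, Fintype (x ⟶ y)] {β : ∀ x y : V, (x ⟶ y) → A}
    (hβ : ∀ x y (α : x ⟶ y), e y * β x y α * e x = β x y α)
    (hli : ∀ x y, LinearIndependent k ((radSq k A).mkQ ∘ β x y)) {t : ∀ x y : V, (x ⟶ y) → k}
    (h : ∑ x, ∑ y, ∑ α : x ⟶ y, t x y α • β x y α ∈ Ring.jacobson A ^ 2) (x y : V)
    (α : x ⟶ y) : t x y α = 0 := by
  have hz : ∀ x' y' (α : x' ⟶ y'), (x' ≠ x ∨ y' ≠ y) → e y * β x' y' α * e x = 0 := by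
    rintro x' y' α (hx | hy)
    · rw [← hβ, mul_assoc, mul_assoc _ _ (e x), he.ortho hx, mul_zero, mul_zero]
    · rw [← hβ, ← mul_assoc, ← mul_assoc, he.ortho hy.symm, zero_mul, zero_mul, zero_mul]
  have key : e y * (∑ x, ∑ y, ∑ α : x ⟶ y, t x y α • β x y α) * e x =
      ∑ α : x ⟶ y, t x y α • β x y α := by
    simp only [Finset.mul_sum, Finset.sum_mul, mul_smul_comm, smul_mul_assoc]
    rw [Finset.sum_eq_single (s := Finset.univ) x, Finset.sum_eq_single (s := Finset.univ) y]
    · simp only [hβ]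
    · intro y' _ hy
      exact Finset.sum_eq_zero fun α _ => by rw [hz _ _ _ (.inr hy), smul_zero]
    · simp
    · intro x' _ hx
      exact Finset.sum_eq_zero fun y' _ => Finset.sum_eq_zero fun α _ => by
        rw [hz _ _ _ (.inl hx), smul_zero]
    · simp
  have hmem : ∑ α : x ⟶ y, t x y α • β x y α ∈ radSq k A :=
    key ▸ Ideal.mul_mem_right _ _ (Ideal.mul_mem_left _ _ h)
  refine Fintype.linearIndependent_iff.1 (hli x y) (t x y) ?_ α
  rw [← (Submodule.Quotient.mk_eq_zero (radSq k A)).2 hmem, ← Submodule.mkQ_apply, map_sum]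
  simp only [map_smul, Function.comp_apply]

/-- The chosen basis elements generate the radical modulo `𝔯²`, hence the radical by nilpotence,
which gives surjectivity. Their independence modulo `𝔯²` puts the kernel in the square of the arrow
ideal. -/
theorem IsAdmissibleBasis.exists_presentation [FiniteDimensional k A] {B : Set A}
    (hB : IsAdmissibleBasis k e B) (he : IsCompletePrimitive e) (hQ : IsOrdinaryQuiver k e) :
    ∃ ν : Presentation k e, ∀ (x y : V) (α : x ⟶ y), ν.hom (arrow k α) ∈ B := by
  choose β hβ hli hcor using fun x y => hB.exists_arrow_elements he hQ x y
  have hfin : ∀ x y : V, Fintype (x ⟶ y) := fun x y =>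
    have := (hQ x y).1
    Fintype.ofFinite _
  have hβ' : ∀ x y (α : x ⟶ y), e y * β x y α * e x = β x y α := fun x y α => (hβ x y α).2
  let φ : PathAlgebra k V →ₐ[k] A := evalHom he.complete hβ'
  have hφ : ∀ x y (α : x ⟶ y), φ (arrow k α) = β x y α := fun x y α => evalHom_arrow _ _ α
  have hφv : ∀ x, φ (vertex k x) = e x := evalHom_vertex _ _
  have hφJ : ∀ x y (α : x ⟶ y), φ.toRingHom (arrow k α) ∈ Ring.jacobson A := fun x y α =>
    show φ (arrow k α) ∈ _ from
      hφ x y α ▸ hB.mem_radical _ (hβ x y α).1.1 (hβ x y α).1.2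
  obtain ⟨n, hn⟩ := isNilpotent_jacobson_of_finiteDimensional (A := A) k
  have hsq : ∀ a ∈ Ring.jacobson A, ∃ s ∈ φ.range, a - s ∈ Ring.jacobson A ^ 2 := by
    intro a ha
    have hle : ∀ x y, corner k (e y) (e x) (rad k A) ≤
        radSq k A ⊔ Subalgebra.toSubmodule φ.range := fun x y =>
      (hcor x y).trans (sup_le_sup_left (Submodule.span_le.2 (by
        rintro _ ⟨α, rfl⟩
        exact ⟨arrow k α, hφ x y α⟩)) _)
    -- Peirce decomposition, reducing the claim to one corner at a time.
    have hsum : a = ∑ y, ∑ x, e y * a * e x := by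
      simp only [← Finset.mul_sum, he.complete.complete, mul_one, ← Finset.sum_mul, one_mul]
    have hmem : a ∈ radSq k A ⊔ Subalgebra.toSubmodule φ.range := by
      rw [hsum]
      exact Submodule.sum_mem _ fun y _ => Submodule.sum_mem _ fun x _ =>
        hle x y (mem_corner.2 ⟨a, ha, rfl⟩)
    obtain ⟨r, hr, s, hs, rfl⟩ := Submodule.mem_sup.1 hmem
    exact ⟨s, hs, by rwa [add_sub_cancel_right]⟩
  have hJ : ∀ a ∈ Ring.jacobson A, a ∈ φ.range := by
    intro a ha
    obtain ⟨s, hs, h⟩ := exists_mem_sub_mem_jacobson_pow φ.range hsq n ha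
    rw [Submodule.pow_succ, hn, Ideal.zero_eq_bot, Ideal.bot_mul, Ideal.mem_bot,
      sub_eq_zero] at h
    exact h ▸ hs
  -- The nilpotency exponent `n` of the radical may be below `2`; adding `2` meets the bound on `N`.
  refine ⟨⟨φ, fun a => ?_, ⟨n + 2, by omega, fun a ha => ?_, fun a ha => ?_⟩, hφv⟩,
    fun x y α => ?_⟩
  · obtain ⟨c, m, -, hm, rfl⟩ := hB.span_idem_sup a
    refine φ.range.add_mem (φ.range.sum_mem fun x _ => φ.range.smul_mem ⟨_, hφv x⟩ _) (hJ m hm)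
  · have := map_mem_pow_of_mem_arrowIdeal_pow φ.toRingHom _ hφJ _ ha
    rw [Submodule.pow_succ, Submodule.pow_succ, hn, Ideal.zero_eq_bot, Ideal.bot_mul,
      Ideal.bot_mul, Ideal.mem_bot] at this
    exact this
  -- For `a` in the kernel, the image of its part of length at most one lies in `𝔯²`. Its vertex
  -- coefficients vanish modulo `𝔯`, then its arrow coefficients modulo `𝔯²`.
  · obtain ⟨c, t, hct⟩ := exists_sub_mem_arrowIdeal_sq a
    have h1 : φ _ ∈ _ := map_mem_pow_of_mem_arrowIdeal_pow φ.toRingHom _ hφJ _ hct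
    have h0 : φ a = 0 := ha
    rw [map_sub, h0, zero_sub, Ideal.neg_mem_iff, map_add] at h1
    simp only [map_sum, map_smul, hφ, hφv] at h1
    have hJ2 : Ring.jacobson A ^ 2 ≤ Ring.jacobson A := by
      rw [Submodule.pow_succ]; exact Ideal.mul_le_right
    have hc : ∀ x, c x = 0 := he.eq_zero_of_sum_mem_jacobson <|
      (Submodule.add_mem_iff_left _ (Submodule.sum_mem _ fun x _ => Submodule.sum_mem _ fun y _ =>
        Submodule.sum_mem _ fun α _ => Submodule.smul_of_tower_mem _ _
          (hB.mem_radical _ (hβ x y α).1.1 (hβ x y α).1.2))).1 (hJ2 h1)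
    simp only [hc, zero_smul, Finset.sum_const_zero, zero_add] at h1
    have ht := sum_smul_eq_zero_of_mem_radSq he.complete hβ' hli h1
    simpa [hc, ht] using hct
  · change φ (arrow k α) ∈ B
    rw [hφ]
    exact (hβ x y α).1.1

end ExistsPresentation

/-! ### Additive weights of walks -/

section WalkWeight

variable {k : Type u} [Field k] {V : Type v} [Quiver.{w} V]

/-- The sum of the weights of the arrows of a walk, an inverse arrow being counted negatively. -/
def walkWeight (t : ∀ x y : V, (x ⟶ y) → k) {x : V} : ∀ {y : V}, Walk x y → k
  | _, Walk.nil => 0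
  | _, Walk.pos p α => walkWeight t p + t _ _ α
  | _, Walk.neg p α => walkWeight t p - t _ _ α

variable (t : ∀ x y : V, (x ⟶ y) → k)

theorem walkWeight_comp {x y z : V} (p : Walk x y) (q : Walk y z) :
    walkWeight t (p.comp q) = walkWeight t p + walkWeight t q := by
  induction q with
  | nil => simp [Walk.comp, walkWeight]
  | pos q α ih => simp only [Walk.comp, walkWeight, ih, add_assoc]
  | neg q α ih => simp only [Walk.comp, walkWeight, ih, add_sub_assoc]

theorem walkWeight_inv {x y : V} (p : Walk x y) : walkWeight t p.inv = -walkWeight t p := by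
  induction p with
  | nil => simp [Walk.inv, walkWeight]
  | pos p α ih =>
    simp only [Walk.inv, walkWeight_comp, Walk.invArrow, walkWeight, ih]
    ring
  | neg p α ih =>
    simp only [Walk.inv, walkWeight_comp, Walk.ofArrow, walkWeight, ih]
    ring

theorem walkWeight_eq_of_homotopic [Fintype V] {I : Ideal (PathAlgebra k V)}
    (ht : ∀ r, IsMinimalRelation I r → ∀ u ∈ supp r, ∀ v ∈ supp r,
      walkWeight t (Walk.ofPath u.2.2) = walkWeight t (Walk.ofPath v.2.2))
    {x y : V} {p q : Walk x y} (h : Homotopic I p q) : walkWeight t p = walkWeight t q := by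
  induction h with
  | refl => rfl
  | symm _ ih => exact ih.symm
  | trans _ _ ih ih' => exact ih.trans ih'
  | inv_mul α => simp [Walk.ofArrow, Walk.invArrow, Walk.comp, walkWeight]
  | mul_inv α => simp [Walk.ofArrow, Walk.invArrow, Walk.comp, walkWeight]
  | congr p q _ ih => simp only [walkWeight_comp, ih]
  | rel r p q hr hp hq => exact ht r hr _ hp _ hq

/-- The homomorphism `π₁(Q, I, x₀) → k⁺` given by weights of the arrows that are compatible with
the minimal relations of `I`. -/
def walkWeightHom [Fintype V] {I : Ideal (PathAlgebra k V)}
    (ht : ∀ r, IsMinimalRelation I r → ∀ u ∈ supp r, ∀ v ∈ supp r,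
      walkWeight t (Walk.ofPath u.2.2) = walkWeight t (Walk.ofPath v.2.2)) (x₀ : V) :
    Additive (FundGroup I x₀) →+ k :=
  MonoidHom.toAdditiveLeft
    { toFun := Quotient.lift (s := homotopySetoid I x₀)
        (fun p => Multiplicative.ofAdd (walkWeight t p))
        fun _ _ h => congrArg _ (walkWeight_eq_of_homotopic t ht h)
      map_one' := rfl
      map_mul' := fun a b => Quotient.inductionOn₂ a b fun p q =>
        -- The product of the classes of `p` and `q` follows `q` first; commutativity of `k⁺`
        -- absorbs the reversal.
        congrArg Multiplicative.ofAdd ((walkWeight_comp t q p).trans (add_comm _ _)) }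

end WalkWeight

/-! ### Diagonal maps that preserve an ideal -/

section DiagMap

variable {k : Type u} [Field k] {V : Type v} [Quiver.{w} V] [Fintype V]

theorem diagMap_apply (t : AnyPath V → k) (r : PathAlgebra k V) :
    diagMap t r = ∑ p ∈ supp r, t p • coeff r p • path k p := by
  conv_lhs => rw [eq_part r]
  rw [part, map_sum]
  exact Finset.sum_congr rfl fun p _ => by rw [map_smul, diagMap_path, smul_comm]

/-- Multiplying the weights by `t - a` amounts to applying the operator `diagMap t - a`. Products of
such factors are thus polynomials in `diagMap t`. -/
theorem diagMap_mul_sub (s t : AnyPath V → k) (a : k) (r : PathAlgebra k V) :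
    diagMap (fun p => (t p - a) * s p) r = diagMap t (diagMap s r) - a • diagMap s r := by
  rw [diagMap_apply s, diagMap_apply, map_sum, Finset.smul_sum, ← Finset.sum_sub_distrib]
  refine Finset.sum_congr rfl fun p _ => ?_
  simp only [map_smul, diagMap_path, smul_smul, ← sub_smul]
  congr 1
  ring

/-- If a diagonal map preserves the ideal, then it is scalar on each minimal relation. -/
theorem IsMinimalRelation.weight_eq_of_diagMap_mem {I : Ideal (PathAlgebra k V)}
    {t : AnyPath V → k} (ht : ∀ r ∈ I, diagMap t r ∈ I) {r : PathAlgebra k V}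
    (hr : IsMinimalRelation I r) {u v : AnyPath V} (hu : u ∈ supp r) (hv : v ∈ supp r) :
    t u = t v := by
  classical
  by_contra huv
  have hprod : ∀ F : Finset k, diagMap (fun p => ∏ a ∈ F, (t p - a)) r ∈ I := by
    intro F
    induction F using Finset.induction_on with
    | empty =>
      have : diagMap (fun p => ∏ a ∈ (∅ : Finset k), (t p - a)) r = r := by
        rw [diagMap_apply]
        conv_rhs => rw [eq_part r]
        exact Finset.sum_congr rfl fun p _ => by rw [Finset.prod_empty, one_smul]
      exact this.symm ▸ hr.1
    | insert a F ha ih =>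
      simp only [Finset.prod_insert ha]
      rw [diagMap_mul_sub]
      exact I.sub_mem (ht _ ih) (Submodule.smul_of_tower_mem I a ih)
  -- `F` consists of the other eigenvalues on the support, so the product over `F` annihilates
  -- exactly the paths of weight different from `t u`. Up to a non-zero scalar it projects `r` onto
  -- `part r S`.
  set F := ((supp r).image t).erase (t u) with hF
  set S := (supp r).filter fun p => t p = t u with hS
  have hc : ∏ a ∈ F, (t u - a) ≠ 0 := Finset.prod_ne_zero_iff.2 fun a ha =>
    sub_ne_zero.2 (Finset.ne_of_mem_erase ha).symm
  have key : diagMap (fun p => ∏ a ∈ F, (t p - a)) r = (∏ a ∈ F, (t u - a)) • part r S := by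
    rw [diagMap_apply, part, Finset.smul_sum, hS, Finset.sum_filter]
    refine Finset.sum_congr rfl fun p hp => ?_
    split_ifs with h
    · rw [h]
    · rw [Finset.prod_eq_zero (i := t p), zero_smul]
      · exact Finset.mem_erase.2 ⟨h, Finset.mem_image_of_mem t hp⟩
      · exact sub_self _
  refine hr.2.2 S ⟨u, Finset.mem_filter.2 ⟨hu, rfl⟩⟩ ?_ ?_
  -- `S` is proper because it misses `v`.
  · refine Finset.ssubset_iff_subset_ne.2 ⟨Finset.filter_subset _ _, fun h => huv ?_⟩
    exact ((Finset.mem_filter.1 (h.symm ▸ hv : v ∈ S)).2).symm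
  · have := Submodule.smul_of_tower_mem I (∏ a ∈ F, (t u - a))⁻¹ (key ▸ hprod F)
    rwa [smul_smul, inv_mul_cancel₀ hc, one_smul] at this

end DiagMap

/-! ### Derivations that are diagonal on the arrows -/

section DiagonalDerivation

variable {k : Type u} [Field k] {A : Type*} [Ring A] [Algebra k A] {V : Type v}
  [Quiver.{w} V] [Fintype V] {e : V → A}

theorem Presentation.der_path (ν : Presentation k e) (d : Der0 k e)
    {t : ∀ x y : V, (x ⟶ y) → k}
    (ht : ∀ x y (α : x ⟶ y), d.1 (ν.hom (arrow k α)) = t x y α • ν.hom (arrow k α))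
    (u : AnyPath V) :
    d.1 (ν.hom (path k u)) = walkWeight t (Walk.ofPath u.2.2) • ν.hom (path k u) := by
  obtain ⟨x, y, p⟩ := u
  induction p with
  | nil =>
    change d.1 (ν.hom (vertex k x)) = (0 : k) • _
    rw [ν.map_vertex, d.2.2, zero_smul]
  | cons p α ih =>
    change _ = (walkWeight t (Walk.ofPath p) + t _ _ α) • _
    change _ = walkWeight t (Walk.ofPath p) • _ at ih
    rw [path_cons, map_mul, d.2.1, ih, ht, mul_smul_comm, smul_mul_assoc, add_smul]

/-- Lifting `d` to a diagonal operator on `kQ` shows that this operator preserves `Ker ν`. -/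
theorem Presentation.der_hom (ν : Presentation k e) (d : Der0 k e)
    {t : ∀ x y : V, (x ⟶ y) → k}
    (ht : ∀ x y (α : x ⟶ y), d.1 (ν.hom (arrow k α)) = t x y α • ν.hom (arrow k α))
    (a : PathAlgebra k V) :
    d.1 (ν.hom a) = ν.hom (diagMap (fun u => walkWeight t (Walk.ofPath u.2.2)) a) := by
  have : d.1 ∘ₗ ν.hom.toLinearMap =
      ν.hom.toLinearMap ∘ₗ diagMap (fun u => walkWeight t (Walk.ofPath u.2.2)) :=
    lin_ext fun u => by
      simp only [LinearMap.comp_apply, AlgHom.toLinearMap_apply, diagMap_path, map_smul]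
      exact ν.der_path d ht u
  exact LinearMap.congr_fun this a

/-- The class of a derivation that is diagonal on the arrows lies in the image of `θ_ν`. -/
theorem Presentation.mk_mem_range_theta (ν : Presentation k e) (he : OrthogonalIdempotents e)
    {T : WideSubquiver V} (hT : IsMaximalTree T) (x₀ : V) (d : Der0 k e)
    {t : ∀ x y : V, (x ⟶ y) → k}
    (ht : ∀ x y (α : x ⟶ y), d.1 (ν.hom (arrow k α)) = t x y α • ν.hom (arrow k α)) :
    HH1.mk d ∈ Set.range (ν.theta hT x₀) := by
  have hker : ∀ r ∈ RingHom.ker ν.hom,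
      diagMap (fun u => walkWeight t (Walk.ofPath u.2.2)) r ∈ RingHom.ker ν.hom := by
    intro r hr
    rw [RingHom.mem_ker] at hr ⊢
    rw [← ν.der_hom d ht, hr, map_zero]
  have hrel := fun r hr u hu v hv =>
    IsMinimalRelation.weight_eq_of_diagMap_mem (r := r) (u := u) (v := v) hker hr hu hv
  refine ⟨walkWeightHom t hrel x₀, ?_⟩
  refine (Submodule.Quotient.eq _).2 ?_
  -- The weights of the tree walks serve as a potential on the vertices. On a path from `x` to `y`,
  -- `f̃ - d` acts by `c x - c y`, whereas the commutator with `∑ c z • e z` acts by `c y - c x`;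
  -- hence the minus sign in the witness.
  set c : V → k := fun x => walkWeight t (treeWalk hT x₀ x) with hc
  refine ⟨-∑ x, c x • e x, neg_mem (Submodule.sum_mem _ fun x _ =>
    Submodule.smul_mem _ _ (Submodule.subset_span ⟨x, rfl⟩)), fun b => ?_⟩
  obtain ⟨a, rfl⟩ := ν.surjective b
  refine lin_ind (p := fun a => (_ : A →ₗ[k] A) (ν.hom a) = _ * ν.hom a - ν.hom a * _) a
    (by simp) (fun a a' h h' => by
      rw [map_add, map_add, h, h', mul_add, add_mul]; abel) fun r u => ?_
  rw [map_smul, map_smul, mul_smul_comm, smul_mul_assoc, ← smul_sub]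
  congr 1
  change ν.tilde hT x₀ _ (ν.hom (path k u)) - d.1 (ν.hom (path k u)) = _
  rw [ν.tilde_path, ν.der_path d ht]
  have hw : weight hT x₀ (walkWeightHom t hrel x₀) u =
      c u.1 + walkWeight t (Walk.ofPath u.2.2) - c u.2.1 := by
    change walkWeight t (closedWalk hT x₀ u) = _
    rw [closedWalk, walkWeight_comp, walkWeight_comp, walkWeight_inv, sub_eq_add_neg]
  obtain ⟨x, y, p⟩ := u
  have hl : e y * ν.hom (path k ⟨x, y, p⟩) = ν.hom (path k ⟨x, y, p⟩) := by
    rw [← ν.map_vertex, ← map_mul, vertex, path_mul_comp, Path.comp_nil]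
  have hr : ν.hom (path k ⟨x, y, p⟩) * e x = ν.hom (path k ⟨x, y, p⟩) := by
    rw [← ν.map_vertex, ← map_mul, vertex, path_mul_comp, Path.nil_comp]
  have hl' : (∑ z, c z • e z) * ν.hom (path k ⟨x, y, p⟩) = c y • ν.hom (path k ⟨x, y, p⟩) := by
    rw [Finset.sum_mul, Finset.sum_eq_single y]
    · rw [smul_mul_assoc, hl]
    · intro z _ hz
      rw [← hl, smul_mul_assoc, ← mul_assoc, he.ortho hz, zero_mul, smul_zero]
    · simp
  have hr' : ν.hom (path k ⟨x, y, p⟩) * (∑ z, c z • e z) = c x • ν.hom (path k ⟨x, y, p⟩) := by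
    nth_rewrite 1 [← hr]
    rw [mul_assoc, mul_sum_smul he, mul_smul_comm, hr]
  rw [hw, neg_mul, mul_neg, hl', hr', ← sub_smul, ← neg_smul, ← neg_smul, ← sub_smul]
  congr 1
  ring

end DiagonalDerivation

end BoundQuiver

end

/-! ### The equivalence -/

theorem proposition2p6 {k : Type*} [Field k] [IsAlgClosed k]
    {A : Type*} [Ring A] [Algebra k A] [FiniteDimensional k A]
    {V : Type*} [Fintype V] [Quiver V] (e : V → A)
    (he : BoundQuiver.IsCompletePrimitive e) (hbasic : BoundQuiver.IsBasic e)
    (hconn : BoundQuiver.IsConnectedAlgebra A) (hQ : BoundQuiver.IsOrdinaryQuiver k e)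
    (hcyc : BoundQuiver.NoOrientedCycles V) {T : WideSubquiver V}
    (hT : BoundQuiver.IsMaximalTree T) (x₀ : V) (D : Set (BoundQuiver.HH1 k e)) :
    BoundQuiver.IsDiagonalizable D ↔
      ∃ ν : BoundQuiver.Presentation k e, D ⊆ Set.range (ν.theta hT x₀) := by
  constructor
  · rintro ⟨B, hB, hD⟩
    -- The presentation is built from `B` before any class `f` is chosen, so it is common to all of
    -- `D`.
    obtain ⟨ν, hν⟩ := hB.exists_presentation he hQ
    refine ⟨ν, fun f hf => ?_⟩
    obtain ⟨d, rfl, hd⟩ := hD f hf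
    choose t ht using fun x y (α : x ⟶ y) => hd _ (hν x y α)
    exact ν.mk_mem_range_theta he.complete.1 hT x₀ d ht
  · rintro ⟨ν, hν⟩
    obtain ⟨B, hB, h⟩ := ν.isDiagonalizable_range_theta he hT x₀
    exact ⟨B, hB, fun f hf => h f (hν hf)⟩
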